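/- Let $n,p\ge 1$, $\theta_0\in\mathbb R^p$, $\sigma,a>0$, and consider the linear model $Y=\mathbf X\theta_0+W$ with random design $\mathbf X\in\mathbb R^{n\times p}$ and noise $W\sim N(0,\sigma^2 I_n)$ independent of $\mathbf X$. Write $\widehat\Sigma=\mathbf X^\top\mathbf X/n$, let $\hat\theta^n=\hat\theta^n(\lambda)$ be a minimizer over $\theta\in\mathbb R^p$ of $\frac1{2n}\|Y-\mathbf X\theta\|_2^2+\lambda\|\theta\|_1$, and put $\mu=a\sqrt{(\log p)/n}$. Let $M=M(\mathbf X)=(m_1,\dots,m_p)^\top$, where $m_i$ is a solution of: minimize $m^\top\widehat\Sigma m$ subject to $\|\widehat\Sigma m-e_i\|_\infty\le\mu$; if one of these $p$ problems is infeasible, put $M=I$. Let $\hat\theta^u=\hat\theta^n+\frac1n M\mathbf X^\top(Y-\mathbf X\hat\theta^n)$. (i) With $Z=M\mathbf X^\top W/\sqrt n$, $$\sqrt n(\hat\theta^u-\theta_0)=Z+\Delta,\qquad Z\mid\mathbf X\sim N(0,\sigma^2M\widehat\Sigma M^\top),\qquad \Delta=\sqrt n\,(M\widehat\Sigma-I)(\theta_0-\hat\theta^n).$$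 (ii) There is a universal constant $0<c_*\le 2000$ such that the following holds. Assume that the rows $X_1,\dots,X_n$ of $\mathbf X$ are i.i.d. with mean zero and covariance matrix $\Sigma$, that all eigenvalues of $\Sigma$ lie in $[C_{\min},C_{\max}]$ with $C_{\min}>0$, that $\max_i\Sigma_{ii}\le 1$, and that $\|\Sigma^{-1/2}X_1\|_{\psi_2}=\kappa\in(0,\infty)$, where $\|\xi\|_{\psi_2}=\sup_{q\ge1}q^{-1/2}(\mathbb E|\xi|^q)^{1/q}$ for a random variable and $\|V\|_{\psi_2}=\sup_{\|u\|_2=1}\|\langle V,u\rangle\|_{\psi_2}$ for a random vector. Let $s_0\ge1$ be an integer with $|\operatorname{supp}(\theta_0)|\le s_0$, let $c>0$ and $\lambda=\sigma\sqrt{(c^2\log p)/n}$, and let $$n\ge\max\bigl(\nu_0\,s_0\log(\max(p/s_0,2)),\ \nu_1\log p\bigr),$$ $$\nu_0=5\cdot10^4c_*\Bigl(\frac{C_{\max}}{C_{\min}}\Bigr)^2\kappa^4,\qquad \nu_1=\max\Bigl(1600\kappa^4,\frac{a^2}{4e^2\kappa^4}\Bigr).$$ (For $s_0\le p/2$ the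 first term is $\nu_0s_0\log(p/s_0)$.) Then $$\mathbb P\Bigl\{\|\Delta\|_\infty\ge\frac{16ac\,\sigma}{C_{\min}}\,\frac{s_0\log p}{\sqrt n}\Bigr\}\le 4e^{-c_1n}+4p^{-\min(\tilde c_0,c_2)},$$ $$\tilde c_0=\frac{c^2}{48}-1,\qquad c_1=\frac1{4c_*\kappa^4},\qquad c_2=\frac{a^2C_{\min}}{24e^2\kappa^4C_{\max}}-2.$$ (iii) The bound in (ii) holds, with $\Delta=\sqrt n(M\widehat\Sigma-I)(\theta_0-\hat\theta^n)$, for every matrix $M$ that is a function of $\mathbf X$ and satisfies, entrywise, $|M\widehat\Sigma-I|_\infty\le\mu$ whenever some matrix does. -/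

import Mathlib

open MeasureTheory ProbabilityTheory Matrix
open scoped ENNReal NNReal

namespace DebiasedLasso

noncomputable section

variable {n p : ℕ}

/-- Matrices carry the product (Borel) sigma-algebra of their entries. -/
instance matrixMeasurableSpace : MeasurableSpace (Matrix (Fin n) (Fin p) ℝ) :=
  inferInstanceAs (MeasurableSpace (Fin n → Fin p → ℝ))

/-- The sample covariance `xᵀ x / n` of the design matrix `x`. -/
def sampleCov (x : Matrix (Fin n) (Fin p) ℝ) : Matrix (Fin p) (Fin p) ℝ :=
  (1 / (n : ℝ)) • (xᵀ * x)

/-- The LASSO objective `‖y - x θ‖₂² / (2 n) + lam ‖θ‖₁`. -/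
def lassoObjective (y : Fin n → ℝ) (x : Matrix (Fin n) (Fin p) ℝ) (lam : ℝ)
    (θ : Fin p → ℝ) : ℝ :=
  1 / (2 * (n : ℝ)) * ∑ i, (y i - (x *ᵥ θ) i) ^ 2 + lam * ∑ j, |θ j|

/-- `θ` is a LASSO estimate: a global minimizer of the LASSO objective. -/
def IsLasso (y : Fin n → ℝ) (x : Matrix (Fin n) (Fin p) ℝ) (lam : ℝ) (θ : Fin p → ℝ) : Prop :=
  ∀ θ', lassoObjective y x lam θ ≤ lassoObjective y x lam θ'

/-- Feasibility of `m` in the `i`-th convex program: `‖S m - e_i‖_∞ ≤ mu`.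
The norm on `Fin p → ℝ` is the sup norm. -/
def RowFeasible (mu : ℝ) (S : Matrix (Fin p) (Fin p) ℝ) (i : Fin p) (m : Fin p → ℝ) : Prop :=
  ‖S *ᵥ m - Pi.single i 1‖ ≤ mu

/-- `m` solves the `i`-th convex program: minimize `mᵀ S m` subject to `‖S m - e_i‖_∞ ≤ mu`. -/
def RowSolution (mu : ℝ) (S : Matrix (Fin p) (Fin p) ℝ) (i : Fin p) (m : Fin p → ℝ) : Prop :=
  RowFeasible mu S i m ∧ ∀ m', RowFeasible mu S i m' → m ⬝ᵥ (S *ᵥ m) ≤ m' ⬝ᵥ (S *ᵥ m')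

/-- `M` is an admissible debiasing matrix of the algorithm with input `x`, `mu`: its rows solve the
`p` convex programs if all of these are feasible, and `M` is the identity otherwise. -/
def IsAlgorithmMatrix (mu : ℝ) (x : Matrix (Fin n) (Fin p) ℝ) (M : Matrix (Fin p) (Fin p) ℝ) :
    Prop :=
  ((∀ i, ∃ m, RowFeasible mu (sampleCov x) i m) → ∀ i, RowSolution mu (sampleCov x) i (M i)) ∧
  ((¬ ∀ i, ∃ m, RowFeasible mu (sampleCov x) i m) → M = 1)

/-- Feasibility of a whole matrix, `|M Σ̂ - I|_∞ ≤ mu` with the entrywise maximum norm. -/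
def MatrixFeasible (mu : ℝ) (x : Matrix (Fin n) (Fin p) ℝ) (M : Matrix (Fin p) (Fin p) ℝ) : Prop :=
  ∀ i j, |(M * sampleCov x - 1) i j| ≤ mu

/-- The debiased estimator `θ + (1 / n) M xᵀ (y - x θ)` built on the LASSO estimate `θ`. -/
def debiased (M : Matrix (Fin p) (Fin p) ℝ) (y : Fin n → ℝ) (x : Matrix (Fin n) (Fin p) ℝ)
    (θ : Fin p → ℝ) : Fin p → ℝ :=
  θ + (1 / (n : ℝ)) • ((M * xᵀ) *ᵥ (y - x *ᵥ θ))

/-- The noise term `Z = M xᵀ w / √n`. -/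
def noiseTerm (M : Matrix (Fin p) (Fin p) ℝ) (x : Matrix (Fin n) (Fin p) ℝ) (w : Fin n → ℝ) :
    Fin p → ℝ :=
  (1 / √(n : ℝ)) • ((M * xᵀ) *ᵥ w)

/-- The bias term `Δ = √n (M Σ̂ - I) (θ₀ - θ)`. -/
def biasTerm (M : Matrix (Fin p) (Fin p) ℝ) (x : Matrix (Fin n) (Fin p) ℝ) (θ₀ θ : Fin p → ℝ) :
    Fin p → ℝ :=
  √(n : ℝ) • ((M * sampleCov x - 1) *ᵥ (θ₀ - θ))

variable {Ω : Type*} [MeasurableSpace Ω]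

/-- The linear model `Y = X θ₀ + W` with `W ~ N(0, σ² I)` independent of the design `X`. -/
structure LinearModel (P : Measure Ω) (X : Ω → Matrix (Fin n) (Fin p) ℝ) (W Y : Ω → Fin n → ℝ)
    (θ₀ : Fin p → ℝ) (σ : ℝ) : Prop where
  aemeasurable_design : AEMeasurable X P
  noise_law : HasLaw W (Measure.pi fun _ : Fin n => gaussianReal 0 (Real.toNNReal (σ ^ 2))) P
  indep : IndepFun X W P
  response : ∀ ω, Y ω = X ω *ᵥ θ₀ + W ω

/-- The sub-Gaussian norm `sup_{q ≥ 1} q^{-1/2} (E |ξ|^q)^{1/q}` of a real random variable. -/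
def psi2Norm (P : Measure Ω) (ξ : Ω → ℝ) : ℝ≥0∞ :=
  ⨆ (q : ℝ) (_ : 1 ≤ q), ENNReal.ofReal (q ^ (-(1 / 2) : ℝ)) * eLpNorm ξ (ENNReal.ofReal q) P

/-- The sub-Gaussian norm of a random vector: the supremum of the sub-Gaussian norms of
`⟨V, u⟩` over the Euclidean unit sphere. -/
def psi2NormVec (P : Measure Ω) (V : Ω → Fin p → ℝ) : ℝ≥0∞ :=
  ⨆ (u : Fin p → ℝ) (_ : ∑ j, u j ^ 2 = 1), psi2Norm P fun ω => V ω ⬝ᵥ u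

/-- The inverse square root `S^{-1/2}` of a symmetric positive definite matrix, by the spectral
functional calculus. -/
def invSqrt (S : Matrix (Fin p) (Fin p) ℝ) : Matrix (Fin p) (Fin p) ℝ :=
  cfc (fun t : ℝ => (√t)⁻¹) S

/-- The random design: the rows of `X` are i.i.d. and centred with covariance matrix `S`,
the eigenvalues of `S` lie in `[Cmin, Cmax]`, the diagonal entries of `S` are at most `1`,
and the rows of `X S^{-1/2}` have sub-Gaussian norm `κ`. -/
structure SubGaussianDesign (P : Measure Ω) (X : Ω → Matrix (Fin n) (Fin p) ℝ)
    (S : Matrix (Fin p) (Fin p) ℝ) (Cmin Cmax κ : ℝ) : Prop where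
  symm : S.IsHermitian
  eigenvalues_mem : ∀ j, symm.eigenvalues j ∈ Set.Icc Cmin Cmax
  diag_le : ∀ j, S j j ≤ 1
  indep_rows : iIndepFun (fun (k : Fin n) ω => X ω k) P
  ident_rows : ∀ k l : Fin n, IdentDistrib (fun ω => X ω k) (fun ω => X ω l) P P
  mean_zero : ∀ k j, ∫ ω, X ω k j ∂P = 0
  covariance : ∀ k i j, ∫ ω, X ω k i * X ω k j ∂P = S i j
  psi2 : ∀ k, psi2NormVec P (fun ω => (X ω * invSqrt S) k) = ENNReal.ofReal κ

end

end DebiasedLasso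

/-! The bias obeys ‖Δ‖_∞ ≤ √n |MΣ̂ − I|_∞ ‖θ₀ − θ̂‖₁. Feasibility of M bounds the middle factor by μ
= a√(log p / n), and the ℓ₁ error of the LASSO is at most 8λs₀/Cmin, so the product has the order s₀
log p / √n, with constant 8 where 16 is allowed.

Apart from the Gaussian noise, everything random comes from one concentration inequality. A product
of two linear forms in a row of X is sub-exponential, so Bernstein's inequality
(`bernstein_of_moments`) keeps uᵀΣ̂v close to uᵀΣv for fixed u and v (`measure_sampleCov_ge_le`,
`measure_sampleCov_le_le`). Union bounds apply it to three finite families: the diagonal of Σ̂; the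
quadratic form of Σ̂ at sums of k signed basis vectors, with k of order s₀Cmax/Cmin; and the entries
of Σ⁻¹Σ̂ − I. The last family shows that Σ⁻¹ is feasible, hence that M is.

The restricted eigenvalue bound needs no net of sparse unit vectors. Maurey's argument
(`exists_multiset_quadForm_le`) represents h as a mean of scaled vectors ±e_j and replaces it by an
average of m + 1 of them. A form that is nonnegative at all such sums is therefore bounded below
everywhere up to a multiple of ‖h‖₁²/m (`quadForm_ge_of_forall_multiset`). LASSO errors satisfy
‖h‖₁² ≤ 16s₀‖h‖₂², so this correction is absorbed (`restricted_eigenvalue`, `IsLasso.l1_error_le`).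

The decomposition is algebra from Y − Xθ̂ = W + X(θ₀ − θ̂). By independence, the conditional law of
Z is found by freezing X and taking a linear image of W. -/

namespace DebiasedLasso

/-! ### Exponential moments and Bernstein's inequality. -/

section

theorem natCast_pow_div_factorial_le (q : ℕ) : (q : ℝ) ^ q / q.factorial ≤ Real.exp 1 ^ q := by
  rw [← Real.exp_nat_mul, mul_one]
  exact Real.pow_div_factorial_le_exp _ (Nat.cast_nonneg q) q

theorem hasSum_exp_abs_sub (x : ℝ) :
    HasSum (fun q : ℕ => |x| ^ (q + 2) / (q + 2).factorial) (Real.exp |x| - 1 - |x|) := by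
  have h := NormedSpace.expSeries_div_hasSum_exp (𝔸 := ℝ) |x|
  rw [← Real.exp_eq_exp_ℝ] at h
  have := (hasSum_nat_add_iff' 2).2 h
  simpa [Finset.sum_range_succ, sub_sub] using this

/-- Keeping the linear term apart lets the mean enter exactly; absolute moments are needed only from
order two on. For negative x the claim is y ≤ sinh y at y = −x. -/
theorem exp_le_one_add_add_exp_abs_sub (x : ℝ) :
    Real.exp x ≤ 1 + x + (Real.exp |x| - 1 - |x|) := by
  rcases le_total 0 x with h | h
  · rw [abs_of_nonneg h]; linarith
  · rw [abs_of_nonpos h]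
    have := Real.self_le_sinh_iff.2 (neg_nonneg.2 h)
    rw [Real.sinh_eq, neg_neg] at this
    linarith

variable {Ω : Type*} [MeasurableSpace Ω] {P : Measure Ω}

/-- If the moments of `ξ` grow like `(q K)^q`, then the exponential remainder
`e^|tξ| - 1 - |tξ|` is integrable with a geometric bound on its mean. -/
theorem integrable_exp_abs_sub_and_integral_le [IsProbabilityMeasure P] {ξ : Ω → ℝ} {K x : ℝ}
    (hK : 0 < K) (hx : 0 ≤ x) (hx1 : x < 1)
    (hint : ∀ q : ℕ, Integrable (fun ω => |ξ ω| ^ q) P)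
    (hmom : ∀ q : ℕ, 1 ≤ q → ∫ ω, |ξ ω| ^ q ∂P ≤ (q * K) ^ q) :
    Integrable (fun ω => Real.exp |x / (Real.exp 1 * K) * ξ ω| - 1 -
        |x / (Real.exp 1 * K) * ξ ω|) P ∧
      ∫ ω, (Real.exp |x / (Real.exp 1 * K) * ξ ω| - 1 - |x / (Real.exp 1 * K) * ξ ω|) ∂P ≤
        x ^ 2 / (1 - x) := by
  -- The factor e in the scale absorbs q^q / q! ≤ e^q, so the term of order q has mean at most x^q.
  -- Summing from order two gives x² / (1 − x).
  set t : ℝ := x / (Real.exp 1 * K) with ht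
  have ht0 : 0 ≤ t := by positivity
  let F : ℕ → Ω → ℝ := fun q ω => |t * ξ ω| ^ (q + 2) / (q + 2).factorial
  have hFeq : ∀ q, F q = fun ω => (t ^ (q + 2) / (q + 2).factorial) * |ξ ω| ^ (q + 2) := by
    intro q; ext ω
    simp only [F, abs_mul, mul_pow, abs_of_nonneg ht0]; ring
  have hF0 : ∀ q ω, 0 ≤ F q ω := fun q ω => by positivity
  have hFint : ∀ q, Integrable (F q) P := by
    intro q; rw [hFeq]; exact (hint _).const_mul _
  have hFle : ∀ q, ∫ ω, F q ω ∂P ≤ x ^ 2 * x ^ q := by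
    intro q
    rw [hFeq, integral_const_mul]
    calc t ^ (q + 2) / (q + 2).factorial * ∫ ω, |ξ ω| ^ (q + 2) ∂P
        ≤ t ^ (q + 2) / (q + 2).factorial * (((q + 2 : ℕ) : ℝ) * K) ^ (q + 2) := by
          gcongr; exact hmom _ (by omega)
      _ = (t * K) ^ (q + 2) * ((((q + 2 : ℕ) : ℝ)) ^ (q + 2) / (q + 2).factorial) := by
          rw [mul_pow, mul_pow]; ring
      _ ≤ (t * K) ^ (q + 2) * Real.exp 1 ^ (q + 2) := by
          gcongr; exact natCast_pow_div_factorial_le _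
      _ = x ^ 2 * x ^ q := by
          rw [← mul_pow, show t * K * Real.exp 1 = x by rw [ht]; field_simp]; ring
  have hgeo := (hasSum_geometric_of_lt_one hx hx1).mul_left (x ^ 2)
  have hnorm : ∀ q, ∫ ω, ‖F q ω‖ ∂P = ∫ ω, F q ω ∂P := by
    intro q; simp only [Real.norm_of_nonneg (hF0 q _)]
  have hsum : Summable fun q => ∫ ω, ‖F q ω‖ ∂P := by
    simp only [hnorm]
    exact Summable.of_nonneg_of_le (fun q => integral_nonneg (hF0 q)) hFle hgeo.summable
  have htsum : ∀ ω, ∑' q, F q ω = Real.exp |t * ξ ω| - 1 - |t * ξ ω| :=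
    fun ω => (hasSum_exp_abs_sub (t * ξ ω)).tsum_eq
  have hI := hasSum_integral_of_summable_integral_norm hFint hsum
  simp only [htsum] at hI
  refine ⟨?_, ?_⟩
  · have hg0 : ∀ ω, 0 ≤ Real.exp |t * ξ ω| - 1 - |t * ξ ω| := fun ω => by
      rw [← htsum]; exact tsum_nonneg fun q => hF0 q ω
    have haesm : AEStronglyMeasurable (fun ω => Real.exp |t * ξ ω| - 1 - |t * ξ ω|) P := by
      have h1 : AEMeasurable (fun ω => |ξ ω|) P := by
        simpa using (hint 1).aemeasurable
      have : (fun ω => Real.exp |t * ξ ω| - 1 - |t * ξ ω|) =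
          fun ω => Real.exp (t * |ξ ω|) - 1 - t * |ξ ω| := by
        ext ω; rw [abs_mul, abs_of_nonneg ht0]
      rw [this]
      exact AEMeasurable.aestronglyMeasurable (by fun_prop)
    refine ⟨haesm, ?_⟩
    rw [hasFiniteIntegral_iff_ofReal (Filter.Eventually.of_forall hg0)]
    have : ∀ ω, ENNReal.ofReal (Real.exp |t * ξ ω| - 1 - |t * ξ ω|) =
        ∑' q, ENNReal.ofReal (F q ω) := fun ω => by
      rw [← htsum, ENNReal.ofReal_tsum_of_nonneg (fun q => hF0 q ω)
        (hasSum_exp_abs_sub (t * ξ ω)).summable]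
    simp only [this]
    rw [lintegral_tsum fun q => (hFint q).aemeasurable.ennreal_ofReal]
    simp only [← ofReal_integral_eq_lintegral_ofReal (hFint _)
      (Filter.Eventually.of_forall (hF0 _))]
    rw [← ENNReal.ofReal_tsum_of_nonneg (fun q => integral_nonneg (hF0 q)) hI.summable]
    exact ENNReal.ofReal_lt_top
  · rw [div_eq_mul_inv]
    exact hasSum_le hFle hI hgeo

theorem integrable_exp_mul_and_mgf_le [IsProbabilityMeasure P] {ξ : Ω → ℝ} {K x : ℝ}
    (hK : 0 < K) (hx : 0 ≤ x) (hx1 : x < 1) (hmeas : AEMeasurable ξ P)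
    (hint : ∀ q : ℕ, Integrable (fun ω => |ξ ω| ^ q) P)
    (hmom : ∀ q : ℕ, 1 ≤ q → ∫ ω, |ξ ω| ^ q ∂P ≤ (q * K) ^ q) :
    Integrable (fun ω => Real.exp (x / (Real.exp 1 * K) * ξ ω)) P ∧
      mgf ξ P (x / (Real.exp 1 * K)) ≤
        Real.exp (x / (Real.exp 1 * K) * (∫ ω, ξ ω ∂P) + x ^ 2 / (1 - x)) := by
  obtain ⟨h1, h2⟩ := integrable_exp_abs_sub_and_integral_le hK hx hx1 hint hmom
  set t : ℝ := x / (Real.exp 1 * K) with ht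
  have hξ : Integrable ξ P := by
    have := hint 1
    simp only [pow_one] at this
    exact (integrable_norm_iff hmeas.aestronglyMeasurable).1 this
  have hdom : Integrable (fun ω => 1 + t * ξ ω +
      (Real.exp |t * ξ ω| - 1 - |t * ξ ω|)) P :=
    ((integrable_const _).add (hξ.const_mul _)).add h1
  have hexp : Integrable (fun ω => Real.exp (t * ξ ω)) P := by
    refine hdom.mono' (AEMeasurable.aestronglyMeasurable (by fun_prop)) ?_
    refine Filter.Eventually.of_forall fun ω => ?_
    rw [Real.norm_of_nonneg (Real.exp_pos _).le]
    exact exp_le_one_add_add_exp_abs_sub _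
  refine ⟨hexp, ?_⟩
  calc mgf ξ P t ≤ ∫ ω, (1 + t * ξ ω + (Real.exp |t * ξ ω| - 1 - |t * ξ ω|)) ∂P :=
        integral_mono hexp hdom fun ω => exp_le_one_add_add_exp_abs_sub _
    _ = 1 + t * (∫ ω, ξ ω ∂P) + ∫ ω, (Real.exp |t * ξ ω| - 1 - |t * ξ ω|) ∂P := by
        rw [integral_add (f := fun ω => 1 + t * ξ ω) ((integrable_const _).add (hξ.const_mul _)) h1,
          integral_add (integrable_const _) (hξ.const_mul _), integral_const_mul]
        simp
    _ ≤ (t * (∫ ω, ξ ω ∂P) + x ^ 2 / (1 - x)) + 1 := by linarith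
    _ ≤ _ := Real.add_one_le_exp _

/-- **Bernstein's inequality** for independent variables with sub-exponential moments. -/
theorem bernstein_of_moments [IsProbabilityMeasure P] {n : ℕ} {ξ : Fin n → Ω → ℝ} {K m y : ℝ}
    (hK : 0 < K) (hy : 0 ≤ y) (hy1 : y ≤ 1) (hindep : iIndepFun ξ P)
    (hmeas : ∀ k, AEMeasurable (ξ k) P)
    (hint : ∀ k, ∀ q : ℕ, Integrable (fun ω => |ξ k ω| ^ q) P)
    (hmom : ∀ k, ∀ q : ℕ, 1 ≤ q → ∫ ω, |ξ k ω| ^ q ∂P ≤ (q * K) ^ q)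
    (hmean : ∀ k, ∫ ω, ξ k ω ∂P = m) :
    P {ω | n * (m + y * (Real.exp 1 * K)) ≤ ∑ k, ξ k ω} ≤
      ENNReal.ofReal (Real.exp (-(n * (y ^ 2 / 6)))) := by
  -- Chernoff's bound with tilt (y/3)/(eK): the deviation gains y²/3, the moment generating function
  -- costs (y/3)²/(1 − y/3) ≤ y²/6 because y ≤ 1, and y²/6 remains per observation.
  have hx : 0 ≤ y / 3 := by positivity
  have hx1 : y / 3 < 1 := by linarith
  have hk := fun k => integrable_exp_mul_and_mgf_le hK hx hx1 (hmeas k) (hint k) (hmom k)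
  simp only [hmean] at hk
  set t : ℝ := y / 3 / (Real.exp 1 * K) with ht
  have ht0 : 0 ≤ t := by positivity
  have hmgf : mgf (∑ k, ξ k) P t ≤ Real.exp (n * (t * m + (y / 3) ^ 2 / (1 - y / 3))) := by
    rw [hindep.mgf_sum₀ (fun k => hmeas k)]
    calc ∏ k, mgf (ξ k) P t ≤ ∏ _k : Fin n, Real.exp (t * m + (y / 3) ^ 2 / (1 - y / 3)) :=
          Finset.prod_le_prod (fun _ _ => mgf_nonneg) fun k _ => (hk k).2
      _ = _ := by simp [← Real.exp_nat_mul]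
  -- A moment generating function is positive exactly where the exponential is integrable, so
  -- integrability for the sum follows from the product formula.
  have hint' : Integrable (fun ω => Real.exp (t * (∑ k, ξ k) ω)) P := by
    rw [← mgf_pos_iff, hindep.mgf_sum₀ (fun k => hmeas k)]
    exact Finset.prod_pos fun k _ => mgf_pos_iff.2 (hk k).1
  have hch := measure_ge_le_exp_mul_mgf (μ := P) (X := ∑ k, ξ k)
    (n * (m + y * (Real.exp 1 * K))) ht0 hint'
  have hfin : Real.exp (-t * (n * (m + y * (Real.exp 1 * K)))) * mgf (∑ k, ξ k) P t ≤
      Real.exp (-(n * (y ^ 2 / 6))) := by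
    refine (mul_le_mul_of_nonneg_left hmgf (Real.exp_pos _).le).trans ?_
    rw [← Real.exp_add]
    apply Real.exp_le_exp.2
    have e1 : t * (y * (Real.exp 1 * K)) = y ^ 2 / 3 := by
      rw [ht]; field_simp
    have e2 : (y / 3) ^ 2 / (1 - y / 3) ≤ y ^ 2 / 6 := by
      rw [div_le_iff₀ (by linarith)]
      nlinarith [sq_nonneg y]
    have hn : (0 : ℝ) ≤ n := Nat.cast_nonneg n
    have : -t * (n * (m + y * (Real.exp 1 * K))) + n * (t * m + (y / 3) ^ 2 / (1 - y / 3)) =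
        n * ((y / 3) ^ 2 / (1 - y / 3) - y ^ 2 / 3) := by rw [← e1]; ring
    rw [this, ← mul_neg]
    exact mul_le_mul_of_nonneg_left (by linarith) hn
  have := hch.trans hfin
  simp only [Finset.sum_apply] at this
  rw [← ofReal_measureReal]
  exact ENNReal.ofReal_le_ofReal this

end

/-! ### Moments of linear forms in a sub-Gaussian row. -/

section

variable {Ω : Type*} [MeasurableSpace Ω] {P : Measure Ω}

/-- A bound on the sub-Gaussian norm bounds all even moments. -/
theorem integrable_pow_and_integral_pow_le_of_psi2Norm_le {ζ : Ω → ℝ} {κ : ℝ} (hκ : 0 ≤ κ)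
    (hmeas : AEMeasurable ζ P) (hψ : psi2Norm P ζ ≤ ENNReal.ofReal κ) {q : ℕ} (hq : 1 ≤ q) :
    Integrable (fun ω => |ζ ω| ^ (2 * q)) P ∧
      ∫ ω, |ζ ω| ^ (2 * q) ∂P ≤ (2 * q * κ ^ 2) ^ q := by
  have hq' : (1 : ℝ) ≤ q := by exact_mod_cast hq
  have h2q : (1 : ℝ) ≤ 2 * q := by linarith
  have h := (le_iSup₂ (f := fun (r : ℝ) (_ : 1 ≤ r) =>
    ENNReal.ofReal (r ^ (-(1 / 2) : ℝ)) * eLpNorm ζ (ENNReal.ofReal r) P) (2 * q : ℝ) h2q).trans hψ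
  have hp : ENNReal.ofReal (2 * q : ℝ) = ((2 * q : ℕ) : ℝ≥0) := by
    rw [ENNReal.coe_natCast, ← ENNReal.ofReal_natCast, Nat.cast_mul, Nat.cast_ofNat]
  rw [hp] at h
  have h0 : ((2 * q : ℕ) : ℝ≥0) ≠ 0 := by
    rw [Nat.cast_ne_zero]; omega
  have h3 := eLpNorm_nnreal_pow_eq_lintegral (f := ζ) (μ := P) h0
  have h4 := ENNReal.rpow_le_rpow h (z := ((2 * q : ℕ) : ℝ≥0)) (by positivity)
  rw [ENNReal.mul_rpow_of_nonneg _ _ (by positivity), h3] at h4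
  simp only [NNReal.coe_natCast, ENNReal.rpow_natCast, ← ofReal_norm,
    Real.norm_eq_abs] at h4
  rw [← ENNReal.ofReal_pow (by positivity), ← ENNReal.ofReal_pow hκ] at h4
  have e : ((2 * q : ℝ) ^ (-(1 / 2) : ℝ)) ^ (2 * q) = ((2 * q : ℝ) ^ q)⁻¹ := by
    rw [← Real.rpow_natCast, ← Real.rpow_mul (by positivity), ← Real.rpow_natCast,
      ← Real.rpow_neg (by positivity)]
    congr 1; push_cast; ring
  rw [e] at h4
  have h5 : ∫⁻ ω, ENNReal.ofReal (|ζ ω| ^ (2 * q)) ∂P ≤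
      ENNReal.ofReal ((2 * q * κ ^ 2) ^ q) := by
    have hc : ENNReal.ofReal ((2 * q : ℝ) ^ q) * ENNReal.ofReal (((2 * q : ℝ) ^ q)⁻¹) = 1 := by
      rw [← ENNReal.ofReal_mul (by positivity), mul_inv_cancel₀ (by positivity),
        ENNReal.ofReal_one]
    have := mul_le_mul_right h4 (ENNReal.ofReal ((2 * q : ℝ) ^ q))
    rw [← mul_assoc, hc, one_mul, ← ENNReal.ofReal_mul (by positivity)] at this
    simp only [← ENNReal.ofReal_pow (abs_nonneg _)] at this
    refine this.trans (le_of_eq ?_)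
    rw [mul_pow (2 * q : ℝ), ← pow_mul]
  have hm : AEStronglyMeasurable (fun ω => |ζ ω| ^ (2 * q)) P :=
    AEMeasurable.aestronglyMeasurable (by fun_prop)
  have hnn : 0 ≤ᵐ[P] fun ω => |ζ ω| ^ (2 * q) :=
    Filter.Eventually.of_forall fun ω => by positivity
  refine ⟨⟨hm, ?_⟩, ?_⟩
  · rw [hasFiniteIntegral_iff_ofReal hnn]
    exact h5.trans_lt ENNReal.ofReal_lt_top
  · rw [integral_eq_lintegral_of_nonneg_ae hnn hm]
    exact ENNReal.toReal_le_of_le_ofReal (by positivity) h5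

section Matrix

variable {p : ℕ} {S : Matrix (Fin p) (Fin p) ℝ} {Cmin Cmax : ℝ}

/-- A square root of `S` whose product with `invSqrt S` is the identity. -/
theorem exists_sqrt_of_eigenvalues_pos (hS : S.IsHermitian) (hpos : ∀ j, 0 < hS.eigenvalues j) :
    ∃ R : Matrix (Fin p) (Fin p) ℝ, Rᵀ * R = S ∧ invSqrt S * R = 1 := by
  have hsa : IsSelfAdjoint S := hS
  have hspec : ∀ x ∈ spectrum ℝ S, 0 < x := by
    intro x hx
    rw [hS.spectrum_real_eq_range_eigenvalues] at hx
    obtain ⟨j, rfl⟩ := hx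
    exact hpos j
  have hc1 : ContinuousOn (fun t : ℝ => √t) (spectrum ℝ S) := Real.continuous_sqrt.continuousOn
  have hc2 : ContinuousOn (fun t : ℝ => (√t)⁻¹) (spectrum ℝ S) :=
    hc1.inv₀ fun x hx => (Real.sqrt_pos.2 (hspec x hx)).ne'
  refine ⟨cfc (fun t : ℝ => √t) S, ?_, ?_⟩
  · have hR : IsSelfAdjoint (cfc (fun t : ℝ => √t) S) := cfc_predicate _ S
    have hT : (cfc (fun t : ℝ => √t) S)ᵀ = cfc (fun t : ℝ => √t) S := by
      have := hR.star_eq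
      rwa [star_eq_conjTranspose, conjTranspose_eq_transpose_of_trivial] at this
    rw [hT, ← cfc_mul (fun t : ℝ => √t) (fun t : ℝ => √t) S hc1 hc1]
    conv_rhs => rw [← cfc_id ℝ S hsa]
    exact cfc_congr fun x hx => Real.mul_self_sqrt (hspec x hx).le
  · rw [invSqrt, ← cfc_mul (fun t : ℝ => (√t)⁻¹) (fun t : ℝ => √t) S hc2 hc1, ← cfc_one ℝ S hsa]
    exact cfc_congr fun x hx => inv_mul_cancel₀ (Real.sqrt_pos.2 (hspec x hx)).ne'

open scoped MatrixOrder in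
theorem mul_sum_sq_le_of_le_eigenvalues (hS : S.IsHermitian) (h : ∀ j, Cmin ≤ hS.eigenvalues j)
    (v : Fin p → ℝ) : Cmin * ∑ j, v j ^ 2 ≤ v ⬝ᵥ (S *ᵥ v) := by
  have hle : algebraMap ℝ (Matrix (Fin p) (Fin p) ℝ) Cmin ≤ S := by
    rw [algebraMap_le_iff_le_spectrum (a := S) hS]
    intro x hx
    rw [hS.spectrum_real_eq_range_eigenvalues] at hx
    obtain ⟨j, rfl⟩ := hx
    exact h j
  have := (Matrix.le_iff.1 hle).dotProduct_mulVec_nonneg v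
  rw [Algebra.algebraMap_eq_smul_one, sub_mulVec, smul_mulVec, one_mulVec, dotProduct_sub,
    dotProduct_smul, star_trivial, smul_eq_mul, sub_nonneg] at this
  simpa [dotProduct, sq] using this

open scoped MatrixOrder in
theorem le_mul_sum_sq_of_eigenvalues_le (hS : S.IsHermitian) (h : ∀ j, hS.eigenvalues j ≤ Cmax)
    (v : Fin p → ℝ) : v ⬝ᵥ (S *ᵥ v) ≤ Cmax * ∑ j, v j ^ 2 := by
  have hle : S ≤ algebraMap ℝ (Matrix (Fin p) (Fin p) ℝ) Cmax := by
    rw [le_algebraMap_iff_spectrum_le (a := S) hS]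
    intro x hx
    rw [hS.spectrum_real_eq_range_eigenvalues] at hx
    obtain ⟨j, rfl⟩ := hx
    exact h j
  have := (Matrix.le_iff.1 hle).dotProduct_mulVec_nonneg v
  rw [Algebra.algebraMap_eq_smul_one, sub_mulVec, smul_mulVec, one_mulVec, dotProduct_sub,
    dotProduct_smul, star_trivial, smul_eq_mul, sub_nonneg] at this
  simpa [dotProduct, sq] using this

end Matrix

namespace SubGaussianDesign

variable {n p : ℕ} {X : Ω → Matrix (Fin n) (Fin p) ℝ} {S : Matrix (Fin p) (Fin p) ℝ}
  {Cmin Cmax κ : ℝ}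

theorem aemeasurable_row (hX : AEMeasurable X P) (k : Fin n) :
    AEMeasurable (fun ω => X ω k) P := by
  have : Measurable fun x : Matrix (Fin n) (Fin p) ℝ => x k :=
    measurable_pi_apply (X := fun _ : Fin n => Fin p → ℝ) k
  exact this.comp_aemeasurable hX

theorem aemeasurable_row_dotProduct (hX : AEMeasurable X P) (k : Fin n) (v : Fin p → ℝ) :
    AEMeasurable (fun ω => X ω k ⬝ᵥ v) P := by
  have : Measurable fun x : Fin p → ℝ => x ⬝ᵥ v := by
    unfold dotProduct; fun_prop
  exact this.comp_aemeasurable (aemeasurable_row hX k)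

theorem quadForm_pos (D : SubGaussianDesign P X S Cmin Cmax κ) (hC : 0 < Cmin)
    {v : Fin p → ℝ} (hv : v ≠ 0) : 0 < v ⬝ᵥ (S *ᵥ v) := by
  refine lt_of_lt_of_le ?_ (mul_sum_sq_le_of_le_eigenvalues D.symm
    (fun j => (D.eigenvalues_mem j).1) v)
  obtain ⟨j, hj⟩ := Function.ne_iff.1 hv
  have : 0 < ∑ j, v j ^ 2 := Finset.sum_pos' (fun _ _ => sq_nonneg _)
    ⟨j, Finset.mem_univ j, by positivity [show v j ≠ 0 from hj]⟩
  positivity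

/-- Whitening: with RᵀR = Σ, the form ⟨X_k, v⟩ equals ⟨Σ^{-1/2}X_k, Rv⟩, and Rv has Euclidean norm
√(vᵀΣv). After normalization the sub-Gaussian norm κ applies. -/
theorem integrable_pow_and_integral_pow_le (D : SubGaussianDesign P X S Cmin Cmax κ)
    (hC : 0 < Cmin) (hκ : 0 < κ) (hX : AEMeasurable X P) (k : Fin n) {v : Fin p → ℝ}
    (hv : v ≠ 0) {q : ℕ} (hq : 1 ≤ q) :
    Integrable (fun ω => |X ω k ⬝ᵥ v| ^ (2 * q)) P ∧
      ∫ ω, |X ω k ⬝ᵥ v| ^ (2 * q) ∂P ≤ (2 * q * κ ^ 2 * (v ⬝ᵥ (S *ᵥ v))) ^ q := by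
  obtain ⟨R, hR, hI⟩ := exists_sqrt_of_eigenvalues_pos D.symm
    fun j => hC.trans_le (D.eigenvalues_mem j).1
  have hpos := D.quadForm_pos hC hv
  set c := √(v ⬝ᵥ (S *ᵥ v)) with hc
  have hc0 : 0 < c := Real.sqrt_pos.2 hpos
  have hcsq : c ^ 2 = v ⬝ᵥ (S *ᵥ v) := Real.sq_sqrt hpos.le
  have hnorm : ∑ j, (c⁻¹ • (R *ᵥ v)) j ^ 2 = 1 := by
    have h1 : ∑ j, (R *ᵥ v) j ^ 2 = c ^ 2 := by
      rw [hcsq, ← hR, ← mulVec_mulVec, dotProduct_mulVec, vecMul_transpose]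
      simp [dotProduct, sq]
    simp only [Pi.smul_apply, smul_eq_mul, mul_pow, ← Finset.mul_sum, h1]
    field_simp
  have hfun : (fun ω => (X ω * invSqrt S) k ⬝ᵥ (c⁻¹ • (R *ᵥ v))) =
      fun ω => c⁻¹ * (X ω k ⬝ᵥ v) := by
    ext ω
    rw [dotProduct_smul, smul_eq_mul, mul_apply_eq_vecMul, ← dotProduct_mulVec, mulVec_mulVec, hI,
      one_mulVec]
  have hψ : psi2Norm P (fun ω => c⁻¹ * (X ω k ⬝ᵥ v)) ≤ ENNReal.ofReal κ := by
    rw [← hfun, ← D.psi2 k, psi2NormVec]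
    exact le_iSup₂ (f := fun (u : Fin p → ℝ) (_ : ∑ j, u j ^ 2 = 1) =>
      psi2Norm P fun ω => (X ω * invSqrt S) k ⬝ᵥ u) _ hnorm
  obtain ⟨h1, h2⟩ := integrable_pow_and_integral_pow_le_of_psi2Norm_le hκ.le
    ((aemeasurable_row_dotProduct hX k v).const_mul _) hψ hq
  have hsc : (fun ω => |X ω k ⬝ᵥ v| ^ (2 * q)) =
      fun ω => c ^ (2 * q) * |c⁻¹ * (X ω k ⬝ᵥ v)| ^ (2 * q) := by
    ext ω
    rw [← abs_of_pos hc0, ← mul_pow, ← abs_mul, abs_of_pos hc0, mul_inv_cancel_left₀ hc0.ne']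
  rw [hsc]
  refine ⟨h1.const_mul _, ?_⟩
  rw [integral_const_mul, mul_pow _ (v ⬝ᵥ _), ← hcsq, ← pow_mul, mul_comm]
  gcongr

end SubGaussianDesign

end

/-! ### Concentration of the sample covariance at fixed vectors. -/

section

theorem dotProduct_sampleCov_mulVec {n p : ℕ} (x : Matrix (Fin n) (Fin p) ℝ) (u v : Fin p → ℝ) :
    u ⬝ᵥ (sampleCov x *ᵥ v) = 1 / (n : ℝ) * ∑ k, (x k ⬝ᵥ u) * (x k ⬝ᵥ v) := by
  rw [sampleCov, smul_mulVec, dotProduct_smul, ← mulVec_mulVec, dotProduct_mulVec,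
    vecMul_transpose, smul_eq_mul]
  rfl

theorem sampleCov_transpose {n p : ℕ} (x : Matrix (Fin n) (Fin p) ℝ) :
    (sampleCov x)ᵀ = sampleCov x := by
  rw [sampleCov, transpose_smul, transpose_mul, transpose_transpose]

namespace SubGaussianDesign

variable {Ω : Type*} [MeasurableSpace Ω] {P : Measure Ω}
variable {n p : ℕ} {X : Ω → Matrix (Fin n) (Fin p) ℝ} {S : Matrix (Fin p) (Fin p) ℝ}
  {Cmin Cmax κ : ℝ}

/-- The weighted inequality 2ab ≤ (β/α)^q a² + (α/β)^q b², applied to q-th powers, replaces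
Cauchy–Schwarz: it yields integrability as well, and the weights balance the two moments so that
only αβ appears. -/
theorem integrable_mul_pow_and_integral_le (D : SubGaussianDesign P X S Cmin Cmax κ)
    (hC : 0 < Cmin) (hκ : 0 < κ) (hX : AEMeasurable X P) (k : Fin n) {u v : Fin p → ℝ}
    (hu : u ≠ 0) (hv : v ≠ 0) {q : ℕ} (hq : 1 ≤ q) :
    Integrable (fun ω => |(X ω k ⬝ᵥ u) * (X ω k ⬝ᵥ v)| ^ q) P ∧
      ∫ ω, |(X ω k ⬝ᵥ u) * (X ω k ⬝ᵥ v)| ^ q ∂P ≤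
        (q * (2 * κ ^ 2 * (√(u ⬝ᵥ (S *ᵥ u)) * √(v ⬝ᵥ (S *ᵥ v))))) ^ q := by
  obtain ⟨hu1, hu2⟩ := D.integrable_pow_and_integral_pow_le hC hκ hX k hu hq
  obtain ⟨hv1, hv2⟩ := D.integrable_pow_and_integral_pow_le hC hκ hX k hv hq
  have hα := Real.sqrt_pos.2 (D.quadForm_pos hC hu)
  have hβ := Real.sqrt_pos.2 (D.quadForm_pos hC hv)
  have hα2 := Real.sq_sqrt (D.quadForm_pos hC hu).le
  have hβ2 := Real.sq_sqrt (D.quadForm_pos hC hv).le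
  set α := √(u ⬝ᵥ (S *ᵥ u))
  set β := √(v ⬝ᵥ (S *ᵥ v))
  rw [← hα2] at hu2
  rw [← hβ2] at hv2
  have hmu := aemeasurable_row_dotProduct hX k u
  have hmv := aemeasurable_row_dotProduct hX k v
  have hdom : ∀ ω, |(X ω k ⬝ᵥ u) * (X ω k ⬝ᵥ v)| ^ q ≤
      2⁻¹ * (β / α) ^ q * |X ω k ⬝ᵥ u| ^ (2 * q) + 2⁻¹ * (α / β) ^ q * |X ω k ⬝ᵥ v| ^ (2 * q) := by
    intro ω
    set a := |X ω k ⬝ᵥ u|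
    set b := |X ω k ⬝ᵥ v|
    have ha : 0 ≤ a := abs_nonneg _
    have hb : 0 ≤ b := abs_nonneg _
    have hr : (β / α) ^ q * (α / β) ^ q = 1 := by
      rw [← mul_pow]; field_simp; simp
    have hr0 : 0 < (β / α) ^ q := by positivity
    have hs : 0 < (α / β) ^ q := by positivity
    rw [abs_mul, mul_pow, mul_comm 2 q, pow_mul, pow_mul]
    have e1 := Real.sq_sqrt hr0.le
    have e2 := Real.sq_sqrt hs.le
    have e3 : √((β / α) ^ q) * √((α / β) ^ q) = 1 := by
      rw [← Real.sqrt_mul hr0.le, hr, Real.sqrt_one]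
    have hsq := sq_nonneg (√((β / α) ^ q) * a ^ q - √((α / β) ^ q) * b ^ q)
    have e4 : (√((β / α) ^ q) * a ^ q - √((α / β) ^ q) * b ^ q) ^ 2 =
        √((β / α) ^ q) ^ 2 * (a ^ q) ^ 2 - 2 * (√((β / α) ^ q) * √((α / β) ^ q)) * (a ^ q * b ^ q)
          + √((α / β) ^ q) ^ 2 * (b ^ q) ^ 2 := by ring
    rw [e4, e1, e2, e3] at hsq
    linarith
  have hdi : Integrable (fun ω => 2⁻¹ * (β / α) ^ q * |X ω k ⬝ᵥ u| ^ (2 * q) +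
      2⁻¹ * (α / β) ^ q * |X ω k ⬝ᵥ v| ^ (2 * q)) P := (hu1.const_mul _).add (hv1.const_mul _)
  have hI : Integrable (fun ω => |(X ω k ⬝ᵥ u) * (X ω k ⬝ᵥ v)| ^ q) P := by
    refine hdi.mono' (AEMeasurable.aestronglyMeasurable (by fun_prop))
      (Filter.Eventually.of_forall fun ω => ?_)
    rw [Real.norm_of_nonneg (by positivity)]
    exact hdom ω
  refine ⟨hI, (integral_mono hI hdi hdom).trans ?_⟩
  rw [integral_add (hu1.const_mul _) (hv1.const_mul _), integral_const_mul, integral_const_mul]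
  calc 2⁻¹ * (β / α) ^ q * (∫ ω, |X ω k ⬝ᵥ u| ^ (2 * q) ∂P) +
        2⁻¹ * (α / β) ^ q * (∫ ω, |X ω k ⬝ᵥ v| ^ (2 * q) ∂P)
      ≤ 2⁻¹ * (β / α) ^ q * (2 * q * κ ^ 2 * α ^ 2) ^ q +
        2⁻¹ * (α / β) ^ q * (2 * q * κ ^ 2 * β ^ 2) ^ q := by gcongr
    _ = 2⁻¹ * (β / α * (2 * q * κ ^ 2 * α ^ 2)) ^ q +
        2⁻¹ * (α / β * (2 * q * κ ^ 2 * β ^ 2)) ^ q := by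
      rw [mul_pow (β / α), mul_pow (α / β)]; ring
    _ = (q * (2 * κ ^ 2 * (α * β))) ^ q := by
      rw [show β / α * (2 * q * κ ^ 2 * α ^ 2) = q * (2 * κ ^ 2 * (α * β)) by field_simp,
        show α / β * (2 * q * κ ^ 2 * β ^ 2) = q * (2 * κ ^ 2 * (α * β)) by field_simp]
      ring

theorem integrable_mul (D : SubGaussianDesign P X S Cmin Cmax κ)
    (hC : 0 < Cmin) (hκ : 0 < κ) (hX : AEMeasurable X P) (k : Fin n) {u v : Fin p → ℝ}
    (hu : u ≠ 0) (hv : v ≠ 0) :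
    Integrable (fun ω => (X ω k ⬝ᵥ u) * (X ω k ⬝ᵥ v)) P := by
  have h := (D.integrable_mul_pow_and_integral_le hC hκ hX k hu hv le_rfl).1
  simp only [pow_one] at h
  exact (integrable_norm_iff ((aemeasurable_row_dotProduct hX k u).mul
    (aemeasurable_row_dotProduct hX k v)).aestronglyMeasurable).1 h

theorem integral_mul_eq (D : SubGaussianDesign P X S Cmin Cmax κ)
    (hC : 0 < Cmin) (hκ : 0 < κ) (hX : AEMeasurable X P) (k : Fin n) (u v : Fin p → ℝ) :
    ∫ ω, (X ω k ⬝ᵥ u) * (X ω k ⬝ᵥ v) ∂P = u ⬝ᵥ (S *ᵥ v) := by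
  have hI : ∀ i j, Integrable (fun ω => X ω k i * X ω k j) P := by
    intro i j
    have := D.integrable_mul hC hκ hX k (u := Pi.single i 1) (v := Pi.single j 1)
      (Pi.single_ne_zero_iff.2 one_ne_zero) (Pi.single_ne_zero_iff.2 one_ne_zero)
    simpa using this
  have e : ∀ ω, (X ω k ⬝ᵥ u) * (X ω k ⬝ᵥ v) =
      ∑ i, ∑ j, u i * v j * (X ω k i * X ω k j) := by
    intro ω
    rw [dotProduct, dotProduct, Finset.sum_mul_sum]
    exact Finset.sum_congr rfl fun i _ => Finset.sum_congr rfl fun j _ => by ring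
  simp only [e]
  rw [integral_finsetSum _ fun i _ => integrable_finsetSum _ fun j _ => (hI i j).const_mul _]
  simp only [dotProduct, mulVec, Finset.mul_sum]
  refine Finset.sum_congr rfl fun i _ => ?_
  rw [integral_finsetSum _ fun j _ => (hI i j).const_mul _]
  refine Finset.sum_congr rfl fun j _ => ?_
  rw [integral_const_mul, D.covariance]
  ring

/-- The second moment bound for a coordinate reads Σ_jj ≤ 2κ²Σ_jj. This lower bound on κ keeps
deviations y proportional to 1/κ² in the range y ≤ 1 of Bernstein's inequality. -/
theorem one_le_two_mul_sq (D : SubGaussianDesign P X S Cmin Cmax κ)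
    (hC : 0 < Cmin) (hκ : 0 < κ) (hX : AEMeasurable X P) (k : Fin n) (j : Fin p) :
    1 ≤ 2 * κ ^ 2 := by
  have hne : (Pi.single j 1 : Fin p → ℝ) ≠ 0 := Pi.single_ne_zero_iff.2 one_ne_zero
  have h1 := (D.integrable_pow_and_integral_pow_le hC hκ hX k hne le_rfl).2
  have h2 := D.integral_mul_eq hC hκ hX k (Pi.single j 1) (Pi.single j 1)
  have hpos := D.quadForm_pos hC hne
  simp only [mul_one, pow_one, sq_abs, Nat.cast_one] at h1
  simp only [← sq] at h2
  rw [h2] at h1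
  by_contra! hlt
  nlinarith

/-- Upper tail of the sample covariance as a bilinear form. -/
theorem measure_sampleCov_ge_le [IsProbabilityMeasure P]
    (D : SubGaussianDesign P X S Cmin Cmax κ) (hn : 0 < n)
    (hC : 0 < Cmin) (hκ : 0 < κ) (hX : AEMeasurable X P) {u v : Fin p → ℝ}
    (hu : u ≠ 0) (hv : v ≠ 0) {y : ℝ} (hy : 0 ≤ y) (hy1 : y ≤ 1) :
    P {ω | u ⬝ᵥ (S *ᵥ v) +
        y * (Real.exp 1 * (2 * κ ^ 2 * (√(u ⬝ᵥ (S *ᵥ u)) * √(v ⬝ᵥ (S *ᵥ v))))) ≤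
          u ⬝ᵥ (sampleCov (X ω) *ᵥ v)} ≤ ENNReal.ofReal (Real.exp (-(n * (y ^ 2 / 6)))) := by
  have hα := Real.sqrt_pos.2 (D.quadForm_pos hC hu)
  have hβ := Real.sqrt_pos.2 (D.quadForm_pos hC hv)
  have hmul : Measurable fun x : Fin p → ℝ => (x ⬝ᵥ u) * (x ⬝ᵥ v) := by
    unfold dotProduct; fun_prop
  have hb := bernstein_of_moments (P := P) (ξ := fun k ω => (X ω k ⬝ᵥ u) * (X ω k ⬝ᵥ v))
    (K := 2 * κ ^ 2 * (√(u ⬝ᵥ (S *ᵥ u)) * √(v ⬝ᵥ (S *ᵥ v)))) (m := u ⬝ᵥ (S *ᵥ v))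
    (by positivity) hy hy1 (D.indep_rows.comp (fun _ x => (x ⬝ᵥ u) * (x ⬝ᵥ v)) fun _ => hmul)
    (fun k => (aemeasurable_row_dotProduct hX k u).mul (aemeasurable_row_dotProduct hX k v))
    (fun k q => by
      rcases Nat.eq_zero_or_pos q with rfl | hq
      · simp
      · exact (D.integrable_mul_pow_and_integral_le hC hκ hX k hu hv hq).1)
    (fun k q hq => (D.integrable_mul_pow_and_integral_le hC hκ hX k hu hv hq).2)
    (fun k => D.integral_mul_eq hC hκ hX k u v)
  refine (measure_mono fun ω hω => ?_).trans hb
  have hn' : (0 : ℝ) < n := by exact_mod_cast hn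
  simp only [Set.mem_ofPred_eq, dotProduct_sampleCov_mulVec] at hω ⊢
  rwa [one_div, inv_mul_eq_div, le_div_iff₀ hn', mul_comm] at hω

/-- Lower tail of the sample covariance as a bilinear form. -/
theorem measure_sampleCov_le_le [IsProbabilityMeasure P]
    (D : SubGaussianDesign P X S Cmin Cmax κ) (hn : 0 < n)
    (hC : 0 < Cmin) (hκ : 0 < κ) (hX : AEMeasurable X P) {u v : Fin p → ℝ}
    (hu : u ≠ 0) (hv : v ≠ 0) {y : ℝ} (hy : 0 ≤ y) (hy1 : y ≤ 1) :
    P {ω | u ⬝ᵥ (sampleCov (X ω) *ᵥ v) ≤ u ⬝ᵥ (S *ᵥ v) -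
        y * (Real.exp 1 * (2 * κ ^ 2 * (√(u ⬝ᵥ (S *ᵥ u)) * √(v ⬝ᵥ (S *ᵥ v)))))} ≤
          ENNReal.ofReal (Real.exp (-(n * (y ^ 2 / 6)))) := by
  have := D.measure_sampleCov_ge_le hn hC hκ hX (neg_ne_zero.2 hu) hv hy hy1
  simp only [mulVec_neg, dotProduct_neg, neg_dotProduct, neg_neg] at this
  refine (measure_mono fun ω hω => ?_).trans this
  simp only [Set.mem_ofPred_eq] at hω ⊢
  linarith

end SubGaussianDesign

end

/-! ### Deterministic part: Maurey's argument, restricted eigenvalues, the LASSO error, algebra of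
the debiasing. -/

section

variable {n p : ℕ}

theorem exists_le_of_sum_mul_le {α : Type*} [Fintype α] {w F : α → ℝ} {c : ℝ}
    (hw : ∀ a, 0 ≤ w a) (hw1 : ∑ a, w a = 1) (h : ∑ a, w a * F a ≤ c) : ∃ a, F a ≤ c := by
  by_contra! hlt
  have h0 : ∑ a, w a * (F a - c) ≤ 0 := by
    simp only [mul_sub, Finset.sum_sub_distrib, ← Finset.sum_mul, hw1]
    linarith
  have h1 : ∀ a, 0 ≤ w a * (F a - c) := fun a => mul_nonneg (hw a) (sub_nonneg.2 (hlt a).le)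
  have h2 := (Finset.sum_eq_zero_iff_of_nonneg fun a _ => h1 a).1
    (le_antisymm h0 (Finset.sum_nonneg fun a _ => h1 a))
  have h3 : ∀ a, w a = 0 := fun a => by
    rcases mul_eq_zero.1 (h2 a (Finset.mem_univ a)) with h | h
    · exact h
    · linarith [hlt a]
  simp [h3] at hw1

/-- Maurey's empirical approximation, derandomized for a quadratic form. -/
theorem exists_multiset_quadForm_le {α : Type*} [Fintype α] (D : Matrix (Fin p) (Fin p) ℝ)
    {w : α → ℝ} (hw : ∀ a, 0 ≤ w a) (hw1 : ∑ a, w a = 1) (v : α → Fin p → ℝ) {h : Fin p → ℝ}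
    (hh : ∑ a, w a • v a = h) (m : ℕ) (z : Fin p → ℝ) :
    ∃ s : Multiset α, s.card = m ∧
      (z + (s.map v).sum) ⬝ᵥ (D *ᵥ (z + (s.map v).sum)) ≤
        (z + (m : ℝ) • h) ⬝ᵥ (D *ᵥ (z + (m : ℝ) • h)) +
          m * (∑ a, w a * (v a ⬝ᵥ (D *ᵥ v a)) - h ⬝ᵥ (D *ᵥ h)) := by
  induction m generalizing z with
  | zero => exact ⟨0, rfl, by simp⟩
  | succ m ih =>
    -- Here c is the point where the m later draws are replaced by their mean h. Averaging over the
    -- present draw turns the cross terms into those of h and adds one variance term; some draw does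
    -- no worse than the average.
    set c := z + (m : ℝ) • h with hc
    have hexp : ∀ u, (c + u) ⬝ᵥ (D *ᵥ (c + u)) =
        c ⬝ᵥ (D *ᵥ c) + (c ⬝ᵥ (D *ᵥ u) + (D *ᵥ c) ⬝ᵥ u) + u ⬝ᵥ (D *ᵥ u) := by
      intro u
      rw [mulVec_add, add_dotProduct, dotProduct_add, dotProduct_add, dotProduct_comm u (D *ᵥ c)]
      ring
    have hlin : ∑ a, w a * (c ⬝ᵥ (D *ᵥ v a) + (D *ᵥ c) ⬝ᵥ v a) =
        c ⬝ᵥ (D *ᵥ h) + (D *ᵥ c) ⬝ᵥ h := by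
      rw [← hh, mulVec_sum, dotProduct_sum, dotProduct_sum, ← Finset.sum_add_distrib]
      refine Finset.sum_congr rfl fun a _ => ?_
      rw [mulVec_smul, dotProduct_smul, dotProduct_smul, smul_eq_mul, smul_eq_mul]
      ring
    obtain ⟨a, ha⟩ := exists_le_of_sum_mul_le (F := fun a => (c + v a) ⬝ᵥ (D *ᵥ (c + v a)))
      (c := (c + h) ⬝ᵥ (D *ᵥ (c + h)) +
        (∑ a, w a * (v a ⬝ᵥ (D *ᵥ v a)) - h ⬝ᵥ (D *ᵥ h))) hw hw1 (by
        simp only [hexp]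
        simp only [mul_add (w _) (_ + _) _, mul_add (w _) (c ⬝ᵥ (D *ᵥ c)) _]
        rw [Finset.sum_add_distrib, Finset.sum_add_distrib, ← Finset.sum_mul, hw1, hlin]
        linarith)
    obtain ⟨s, hs, hq⟩ := ih (z + v a)
    refine ⟨a ::ₘ s, by simp [hs], ?_⟩
    rw [Multiset.map_cons, Multiset.sum_cons, ← add_assoc]
    refine hq.trans ?_
    have e1 : z + v a + (m : ℝ) • h = c + v a := by rw [hc]; abel
    have e2 : z + ((m + 1 : ℕ) : ℝ) • h = c + h := by
      rw [hc]; push_cast; rw [add_smul, one_smul]; abel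
    rw [e1, e2]
    push_cast
    linarith

/-- The vertices `± e_j` of the cross-polytope. -/
def signedBasis (a : Fin p × Bool) : Fin p → ℝ :=
  if a.2 then Pi.single a.1 1 else -Pi.single a.1 1

theorem quadForm_signedBasis (D : Matrix (Fin p) (Fin p) ℝ) (a : Fin p × Bool) :
    signedBasis a ⬝ᵥ (D *ᵥ signedBasis a) = D a.1 a.1 := by
  rcases a with ⟨j, _ | _⟩ <;> simp [signedBasis, mulVec_neg]

theorem sum_posPart_negPart_smul_signedBasis (h : Fin p → ℝ) :
    ∑ a : Fin p × Bool, (if a.2 then max (h a.1) 0 else max (-h a.1) 0) • signedBasis a = h := by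
  ext i
  rw [Fintype.sum_prod_type, Finset.sum_apply]
  have : ∀ j, (∑ b, (if (j, b).2 then max (h (j, b).1) 0 else max (-h (j, b).1) 0) •
      signedBasis (j, b)) i = if i = j then h j else 0 := by
    intro j
    rw [Fintype.sum_bool]
    have : max (h j) 0 - max (-h j) 0 = h j := by
      rcases le_total 0 (h j) with h | h <;> simp [h]
    by_cases hij : i = j
    · subst hij
      simp [signedBasis, ← sub_eq_add_neg, this]
    · simp [signedBasis, hij]
  rw [Finset.sum_congr rfl fun j _ => this j]
  simp

theorem sum_posPart_negPart (h : Fin p → ℝ) :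
    ∑ a : Fin p × Bool, (if a.2 then max (h a.1) 0 else max (-h a.1) 0) = ∑ j, |h j| := by
  rw [Fintype.sum_prod_type]
  refine Finset.sum_congr rfl fun j _ => ?_
  rw [Fintype.sum_bool]
  rcases le_total 0 (h j) with h | h <;> simp [h, abs_of_nonneg, abs_of_nonpos]

/-- A lower bound for a quadratic form on sums of `m + 1` signed basis vectors extends to all
vectors, at the price of an `ℓ₁` correction. -/
theorem quadForm_ge_of_forall_multiset {A B : Matrix (Fin p) (Fin p) ℝ} {C : ℝ} {m : ℕ}
    (hm : 0 < m)
    (hs : ∀ s : Multiset (Fin p × Bool), s.card = m + 1 →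
      3 / 4 * ((s.map signedBasis).sum ⬝ᵥ (B *ᵥ (s.map signedBasis).sum)) ≤
        (s.map signedBasis).sum ⬝ᵥ (A *ᵥ (s.map signedBasis).sum))
    (hA : ∀ j, A j j ≤ 3 / 2 * B j j) (hB : ∀ j, B j j ≤ C) (h : Fin p → ℝ) :
    3 / 4 * (h ⬝ᵥ (B *ᵥ h) - C * (∑ j, |h j|) ^ 2 / m) ≤ h ⬝ᵥ (A *ᵥ h) := by
  set T := ∑ j, |h j| with hT
  have hT0 : 0 ≤ T := Finset.sum_nonneg fun j _ => abs_nonneg _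
  rcases hT0.eq_or_lt with hT0 | hT0
  · have : h = 0 := by
      ext j
      have := (Finset.sum_eq_zero_iff_of_nonneg fun j _ => abs_nonneg (h j)).1 hT0.symm j
        (Finset.mem_univ j)
      simpa using this
    simp [this, ← hT0]
  -- The hypothesis on sums makes D nonnegative at them, and 3/2 − 3/4 = 3/4 bounds its diagonal by
  -- 3C/4.
  set D := A - (3 / 4 : ℝ) • B with hD
  have hDq : ∀ z, z ⬝ᵥ (D *ᵥ z) = z ⬝ᵥ (A *ᵥ z) - 3 / 4 * (z ⬝ᵥ (B *ᵥ z)) := by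
    intro z
    rw [hD, sub_mulVec, smul_mulVec, dotProduct_sub, dotProduct_smul, smul_eq_mul]
  let w : Fin p × Bool → ℝ := fun a => (if a.2 then max (h a.1) 0 else max (-h a.1) 0) / T
  have hw : ∀ a, 0 ≤ w a := fun a => by
    simp only [w]; split_ifs <;> positivity
  have hw1 : ∑ a, w a = 1 := by
    simp only [w, ← Finset.sum_div, sum_posPart_negPart]
    exact div_self hT0.ne'
  have hh : ∑ a, w a • (T • signedBasis a) = h := by
    conv_rhs => rw [← sum_posPart_negPart_smul_signedBasis h]
    refine Finset.sum_congr rfl fun a _ => ?_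
    rw [smul_smul]
    simp only [w]
    rw [div_mul_cancel₀ _ hT0.ne']
  obtain ⟨s, hsc, hsq⟩ := exists_multiset_quadForm_le D hw hw1 (fun a => T • signedBasis a) hh
    (m + 1) 0
  have hmap : (s.map fun a => T • signedBasis a).sum = T • (s.map signedBasis).sum := by
    rw [Multiset.smul_sum, Multiset.map_map]; rfl
  have hq : ∀ (t : ℝ) (z : Fin p → ℝ), (t • z) ⬝ᵥ (D *ᵥ (t • z)) = t ^ 2 * (z ⬝ᵥ (D *ᵥ z)) := by
    intro t z
    rw [mulVec_smul, smul_dotProduct, dotProduct_smul, smul_eq_mul, smul_eq_mul]; ring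
  have hlow : 0 ≤ (s.map signedBasis).sum ⬝ᵥ (D *ᵥ (s.map signedBasis).sum) := by
    rw [hDq]; linarith [hs s hsc]
  have hd : ∑ a, w a * ((T • signedBasis a) ⬝ᵥ (D *ᵥ (T • signedBasis a))) ≤
      T ^ 2 * (3 / 4 * C) := by
    calc _ ≤ ∑ a, w a * (T ^ 2 * (3 / 4 * C)) := by
          refine Finset.sum_le_sum fun a _ => mul_le_mul_of_nonneg_left ?_ (hw a)
          rw [hq, quadForm_signedBasis]
          refine mul_le_mul_of_nonneg_left ?_ (sq_nonneg T)
          simp only [hD, Matrix.sub_apply, Matrix.smul_apply, smul_eq_mul]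
          linarith [hA a.1, hB a.1]
      _ = _ := by rw [← Finset.sum_mul, hw1, one_mul]
  rw [hmap, zero_add, zero_add, hq, hq] at hsq
  have hm' : (0 : ℝ) < m := by exact_mod_cast hm
  have hk : (0 : ℝ) < m + 1 := by positivity
  push_cast at hsq
  -- With m + 1 draws the mean contributes (m + 1)² hᵀDh and the variance removes (m + 1) hᵀDh,
  -- which leaves the factor m.
  have h1 : 0 ≤ (m + 1) * (m * (h ⬝ᵥ (D *ᵥ h)) + T ^ 2 * (3 / 4 * C)) := by
    have : 0 ≤ T ^ 2 * ((s.map signedBasis).sum ⬝ᵥ (D *ᵥ (s.map signedBasis).sum)) :=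
      mul_nonneg (sq_nonneg T) hlow
    nlinarith [mul_le_mul_of_nonneg_left hd hk.le]
  have h2 := nonneg_of_mul_nonneg_right h1 hk
  rw [hDq] at h2
  have h3 : C * T ^ 2 / m * m = C * T ^ 2 := div_mul_cancel₀ _ hm'.ne'
  nlinarith

/-- The restricted eigenvalue bound on vectors of small `ℓ₁` norm relative to `√s₀ ‖h‖₂`. -/
theorem restricted_eigenvalue {A B : Matrix (Fin p) (Fin p) ℝ} {Cmin Cmax : ℝ} {m s₀ : ℕ}
    (hm : 0 < m) (hCmax : 0 ≤ Cmax)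
    (hs : ∀ s : Multiset (Fin p × Bool), s.card = m + 1 →
      3 / 4 * ((s.map signedBasis).sum ⬝ᵥ (B *ᵥ (s.map signedBasis).sum)) ≤
        (s.map signedBasis).sum ⬝ᵥ (A *ᵥ (s.map signedBasis).sum))
    (hA : ∀ j, A j j ≤ 3 / 2 * B j j) (hB : ∀ j, B j j ≤ Cmax)
    (hmin : ∀ h : Fin p → ℝ, Cmin * ∑ j, h j ^ 2 ≤ h ⬝ᵥ (B *ᵥ h))
    (hms : 48 * s₀ * Cmax ≤ m * Cmin) {h : Fin p → ℝ}
    (hh : (∑ j, |h j|) ^ 2 ≤ 16 * s₀ * ∑ j, h j ^ 2) :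
    Cmin / 2 * ∑ j, h j ^ 2 ≤ h ⬝ᵥ (A *ᵥ h) := by
  refine le_trans ?_ (quadForm_ge_of_forall_multiset hm hs hA hB h)
  have hm' : (0 : ℝ) < m := by exact_mod_cast hm
  have hN : 0 ≤ ∑ j, h j ^ 2 := Finset.sum_nonneg fun j _ => sq_nonneg _
  -- The factor 48 = 3 · 16 makes the correction at most a third of the main term, and 3/4 · (1 −
  -- 1/3) = 1/2.
  have h1 : Cmax * (∑ j, |h j|) ^ 2 / m ≤ Cmin / 3 * ∑ j, h j ^ 2 := by
    rw [div_le_iff₀ hm']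
    nlinarith [mul_le_mul_of_nonneg_left hh hCmax, mul_le_mul_of_nonneg_right hms hN]
  linarith [hmin h]

/-- Deterministic `ℓ₁` error bound for the LASSO. -/
theorem IsLasso.l1_error_le {y w : Fin n → ℝ} {x : Matrix (Fin n) (Fin p) ℝ} {lam Cmin : ℝ}
    {θ₀ θ : Fin p → ℝ} {s₀ : ℕ} (hθ : IsLasso y x lam θ) (hy : y = x *ᵥ θ₀ + w) (hn : 0 < n)
    (hlam : 0 < lam) (hC : 0 < Cmin) (hs : {j | θ₀ j ≠ 0}.ncard ≤ s₀)
    (hnoise : ∀ j, |(xᵀ *ᵥ w) j| ≤ n * (lam / 2))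
    (hRE : ∀ h : Fin p → ℝ, (∑ j, |h j|) ^ 2 ≤ 16 * s₀ * ∑ j, h j ^ 2 →
      Cmin / 2 * ∑ j, h j ^ 2 ≤ h ⬝ᵥ (sampleCov x *ᵥ h)) :
    ∑ j, |θ₀ j - θ j| ≤ 8 * lam * s₀ / Cmin := by
  classical
  have hn' : (0 : ℝ) < n := by exact_mod_cast hn
  set h := θ - θ₀ with hh
  have hθh : θ = θ₀ + h := by rw [hh]; abel
  set T := ∑ j, |h j| with hT
  have hT0 : 0 ≤ T := Finset.sum_nonneg fun j _ => abs_nonneg _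
  set U := ∑ j with θ₀ j ≠ 0, |h j| with hU
  set N := ∑ j, h j ^ 2 with hN
  set Q := h ⬝ᵥ (sampleCov x *ᵥ h) with hQ
  have hN0 : 0 ≤ N := Finset.sum_nonneg fun j _ => sq_nonneg _
  have hU0 : 0 ≤ U := Finset.sum_nonneg fun j _ => abs_nonneg _
  have hQeq : Q = 1 / n * ∑ i, (x *ᵥ h) i ^ 2 := by
    rw [hQ, dotProduct_sampleCov_mulVec]
    simp only [← sq]; rfl
  have hQ0 : 0 ≤ Q := by rw [hQeq]; positivity
  have hbasic := hθ θ₀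
  simp only [lassoObjective] at hbasic
  have e1 : ∀ i, y i - (x *ᵥ θ₀) i = w i := fun i => by rw [hy]; simp
  have e2 : ∀ i, y i - (x *ᵥ θ) i = w i - (x *ᵥ h) i := fun i => by
    rw [hy, hθh, mulVec_add]; simp only [Pi.add_apply]; ring
  simp only [e1, e2] at hbasic
  have e3 : ∑ i, (w i - (x *ᵥ h) i) ^ 2 =
      ∑ i, w i ^ 2 - 2 * (w ⬝ᵥ (x *ᵥ h)) + ∑ i, (x *ᵥ h) i ^ 2 := by
    rw [dotProduct, Finset.mul_sum, ← Finset.sum_sub_distrib, ← Finset.sum_add_distrib]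
    exact Finset.sum_congr rfl fun i _ => by ring
  have hcross : w ⬝ᵥ (x *ᵥ h) ≤ n * (lam / 2) * T := by
    rw [dotProduct_mulVec, ← mulVec_transpose, dotProduct, hT, Finset.mul_sum]
    refine Finset.sum_le_sum fun j _ => (le_abs_self _).trans ?_
    rw [abs_mul]
    exact mul_le_mul_of_nonneg_right (hnoise j) (abs_nonneg _)
  have hl1 : ∑ j, |θ₀ j| - ∑ j, |θ j| ≤ 2 * U - T := by
    rw [hU, hT, Finset.sum_filter, Finset.mul_sum, ← Finset.sum_sub_distrib,
      ← Finset.sum_sub_distrib]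
    refine Finset.sum_le_sum fun j _ => ?_
    rw [hθh]
    by_cases hj : θ₀ j = 0
    · simp [hj]
    · simp only [ne_eq, hj, not_false_eq_true, if_true, Pi.add_apply]
      have := abs_sub_abs_le_abs_sub (θ₀ j) (θ₀ j + h j)
      rw [sub_add_cancel_left, abs_neg] at this
      linarith
  -- The basic inequality. Dropping Q gives the cone condition T ≤ 4U; keeping Q gives the rate.
  have hmain : Q + lam * T ≤ 4 * lam * U := by
    rw [e3] at hbasic
    have h1 : 1 / (2 * (n : ℝ)) * (∑ i, w i ^ 2 - 2 * (w ⬝ᵥ (x *ᵥ h)) + ∑ i, (x *ᵥ h) i ^ 2) =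
        1 / (2 * (n : ℝ)) * ∑ i, w i ^ 2 - 1 / n * (w ⬝ᵥ (x *ᵥ h)) + Q / 2 := by
      rw [hQeq]; field_simp
    have h2 : 1 / (n : ℝ) * (w ⬝ᵥ (x *ᵥ h)) ≤ lam / 2 * T := by
      calc _ ≤ 1 / (n : ℝ) * (n * (lam / 2) * T) := by gcongr
        _ = _ := by field_simp
    rw [h1] at hbasic
    have h3 := mul_le_mul_of_nonneg_left hl1 hlam.le
    linarith
  have hUN : U ^ 2 ≤ s₀ * N := by
    have hcard : ((Finset.univ.filter fun j => θ₀ j ≠ 0).card : ℝ) ≤ s₀ := by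
      rw [← Set.ncard_coe_finset]
      have : {j | θ₀ j ≠ 0} =
          ((Finset.univ.filter fun j => θ₀ j ≠ 0 : Finset (Fin p)) : Set (Fin p)) := by
        ext; simp
      rw [← this]
      exact_mod_cast hs
    calc U ^ 2 ≤ (Finset.univ.filter fun j => θ₀ j ≠ 0).card * ∑ j with θ₀ j ≠ 0, |h j| ^ 2 :=
          sq_sum_le_card_mul_sum_sq
      _ ≤ s₀ * N := by
          gcongr
          simp only [sq_abs]
          exact Finset.sum_le_univ_sum_of_nonneg fun j => sq_nonneg _
  have hTU : T ≤ 4 * U := by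
    refine le_of_mul_le_mul_left ?_ hlam
    linarith
  have hre := hRE h (by
    calc T ^ 2 ≤ (4 * U) ^ 2 := by gcongr
      _ = 16 * U ^ 2 := by ring
      _ ≤ 16 * (s₀ * N) := by gcongr
      _ = _ := by ring)
  have habs : ∑ j, |θ₀ j - θ j| = T := by
    refine Finset.sum_congr rfl fun j _ => ?_
    rw [abs_sub_comm, hh]; rfl
  rw [habs, le_div_iff₀ hC]
  -- Young's inequality, weighted so that, after multiplication by `lam`, the N term is exactly what
  -- the restricted eigenvalue bound charges to Q. The proof divides by s₀, so s₀ = 0 is separate.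
  have hsN : 4 * U * Cmin ≤ Cmin ^ 2 / (2 * lam) * N + 8 * lam * s₀ := by
    have h1 : 0 ≤ (Cmin * U - 4 * lam * s₀) ^ 2 := sq_nonneg _
    have h2 : 0 ≤ (s₀ : ℝ) := Nat.cast_nonneg _
    rcases h2.eq_or_lt with h2 | h2
    · rw [← h2] at hUN ⊢
      have : U = 0 := by nlinarith
      rw [this]; simp only [mul_zero, zero_mul, add_zero]; positivity
    · have h3 : 4 * U * Cmin * (2 * lam * s₀) ≤
          (Cmin ^ 2 / (2 * lam) * N + 8 * lam * s₀) * (2 * lam * s₀) := by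
        have : (Cmin ^ 2 / (2 * lam) * N + 8 * lam * s₀) * (2 * lam * s₀) =
            Cmin ^ 2 * (s₀ * N) + 16 * lam ^ 2 * s₀ ^ 2 := by field_simp; ring
        rw [this]
        nlinarith [mul_le_mul_of_nonneg_left hUN (sq_nonneg Cmin)]
      exact le_of_mul_le_mul_right h3 (by positivity)
  have h4 : lam * (T * Cmin) ≤ lam * (8 * lam * s₀) := by
    have h5 : lam * (Cmin ^ 2 / (2 * lam) * N) = Cmin * (Cmin / 2 * N) := by field_simp
    have h6 := mul_le_mul_of_nonneg_left hre hC.le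
    have h7 := mul_le_mul_of_nonneg_left hsN hlam.le
    have h8 := mul_le_mul_of_nonneg_right hmain hC.le
    nlinarith
  exact le_of_mul_le_mul_left h4 hlam

theorem norm_biasTerm_le {M : Matrix (Fin p) (Fin p) ℝ} {x : Matrix (Fin n) (Fin p) ℝ}
    {θ₀ θ : Fin p → ℝ} {mu : ℝ} (hmu : 0 ≤ mu) (hM : MatrixFeasible mu x M) :
    ‖biasTerm M x θ₀ θ‖ ≤ √(n : ℝ) * (mu * ∑ j, |θ₀ j - θ j|) := by
  rw [biasTerm, norm_smul, Real.norm_of_nonneg (Real.sqrt_nonneg _)]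
  refine mul_le_mul_of_nonneg_left ?_ (Real.sqrt_nonneg _)
  rw [pi_norm_le_iff_of_nonneg (mul_nonneg hmu (Finset.sum_nonneg fun j _ => abs_nonneg _))]
  intro i
  rw [Real.norm_eq_abs, mulVec, dotProduct, Finset.mul_sum]
  refine (Finset.abs_sum_le_sum_abs _ _).trans (Finset.sum_le_sum fun j _ => ?_)
  rw [abs_mul]
  exact mul_le_mul_of_nonneg_right (hM i j) (abs_nonneg _)

/-- The programs constrain Σ̂m, whereas the matrix condition sees rows of MΣ̂; symmetry of Σ̂
identifies the two. -/
theorem rowFeasible_iff {M : Matrix (Fin p) (Fin p) ℝ} {x : Matrix (Fin n) (Fin p) ℝ} {mu : ℝ}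
    (hmu : 0 ≤ mu) (i : Fin p) :
    RowFeasible mu (sampleCov x) i (M i) ↔ ∀ j, |(M * sampleCov x - 1) i j| ≤ mu := by
  rw [RowFeasible, pi_norm_le_iff_of_nonneg hmu]
  refine forall_congr' fun j => ?_
  rw [Real.norm_eq_abs, Pi.sub_apply, Matrix.sub_apply, mul_apply_eq_vecMul]
  conv_lhs => rw [← sampleCov_transpose, mulVec_transpose]
  rw [one_apply, Pi.single_apply]
  simp only [eq_comm]

/-- The matrix of the algorithm is feasible as soon as some matrix is. -/
theorem IsAlgorithmMatrix.matrixFeasible {M M' : Matrix (Fin p) (Fin p) ℝ}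
    {x : Matrix (Fin n) (Fin p) ℝ} {mu : ℝ} (hmu : 0 ≤ mu) (hM : IsAlgorithmMatrix mu x M)
    (hM' : MatrixFeasible mu x M') : MatrixFeasible mu x M := fun i =>
  (rowFeasible_iff hmu i).1 (hM.1 (fun i => ⟨M' i, (rowFeasible_iff hmu i).2 (hM' i)⟩) i).1

theorem sqrt_smul_debiased_sub (M : Matrix (Fin p) (Fin p) ℝ) {x : Matrix (Fin n) (Fin p) ℝ}
    {y w : Fin n → ℝ} {θ₀ : Fin p → ℝ} (θ : Fin p → ℝ) (hn : 0 < n) (hy : y = x *ᵥ θ₀ + w) :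
    √(n : ℝ) • (debiased M y x θ - θ₀) = noiseTerm M x w + biasTerm M x θ₀ θ := by
  have hn' : (0 : ℝ) < n := by exact_mod_cast hn
  have hs : √(n : ℝ) * (1 / n) = 1 / √(n : ℝ) := by
    have := Real.sq_sqrt hn'.le
    have h0 := Real.sqrt_pos.2 hn'
    field_simp
    exact this
  have e : (M * xᵀ) *ᵥ (y - x *ᵥ θ) = (M * xᵀ) *ᵥ w + (M * (xᵀ * x)) *ᵥ (θ₀ - θ) := by
    rw [hy, show x *ᵥ θ₀ + w - x *ᵥ θ = w + x *ᵥ (θ₀ - θ) by rw [mulVec_sub]; abel, mulVec_add,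
      mulVec_mulVec, Matrix.mul_assoc]
  rw [debiased, noiseTerm, biasTerm, e, sampleCov, sub_mulVec, one_mulVec, Matrix.mul_smul,
    smul_mulVec, ← hs]
  module

end

/-! ### Conditional law of the noise term and Gaussian tails. -/

section

/-- The conditional law of a function of two independent variables given the first one. -/
theorem condDistrib_ae_eq_map_of_indepFun {Ω β γ E : Type*} [MeasurableSpace Ω]
    [MeasurableSpace β] [MeasurableSpace γ] [MeasurableSpace E] [StandardBorelSpace E] [Nonempty E]
    {P : Measure Ω} [IsProbabilityMeasure P] {X : Ω → β} {W : Ω → γ} (hX : AEMeasurable X P)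
    (hW : AEMeasurable W P) (h : IndepFun X W P) {g : β × γ → E} (hg : Measurable g) :
    ∀ᵐ x ∂(P.map X), condDistrib (fun ω => g (X ω, W ω)) X P x =
      (P.map W).map fun w => g (x, w) := by
  have : IsProbabilityMeasure (P.map X) := Measure.isProbabilityMeasure_map hX
  have : IsProbabilityMeasure (P.map W) := Measure.isProbabilityMeasure_map hW
  -- This kernel freezes x and pushes the law of W through g(x, ·). Disintegrations are almost
  -- everywhere unique, so it suffices that η recovers the joint law, which is Fubini for the
  -- product law.
  let η : Kernel β E := (Kernel.id ×ₖ Kernel.const β (P.map W)).map g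
  have hη : ∀ x, η x = (P.map W).map fun w => g (x, w) := by
    intro x
    rw [Kernel.map_apply _ hg, Kernel.prod_apply, Kernel.id_apply, Kernel.const_apply,
      Measure.dirac_prod, Measure.map_map hg measurable_prodMk_left]
    rfl
  have : IsMarkovKernel η := Kernel.IsMarkovKernel.map _ hg
  have hmain : P.map (fun ω => (X ω, g (X ω, W ω))) = P.map X ⊗ₘ η := by
    have hpair : P.map (fun ω => (X ω, W ω)) = (P.map X).prod (P.map W) :=
      (indepFun_iff_map_prod_eq_prod_map_map hX hW).1 h
    have hG : Measurable fun z : β × γ => (z.1, g z) := measurable_fst.prodMk hg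
    have e : P.map (fun ω => (X ω, g (X ω, W ω))) =
        ((P.map X).prod (P.map W)).map fun z => (z.1, g z) := by
      rw [← hpair, AEMeasurable.map_map_of_aemeasurable hG.aemeasurable (hX.prodMk hW)]
      rfl
    rw [e]
    ext s hs
    rw [Measure.map_apply hG hs, Measure.prod_apply (hG hs), Measure.compProd_apply hs]
    refine lintegral_congr fun x => ?_
    have hgx : Measurable fun w => g (x, w) := hg.comp measurable_prodMk_left
    rw [hη, Measure.map_apply hgx (measurable_prodMk_left hs)]
    rfl
  have hY : AEMeasurable (fun ω => g (X ω, W ω)) P := hg.comp_aemeasurable (hX.prodMk hW)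
  filter_upwards [condDistrib_ae_eq_of_measure_eq_compProd X hY hmain] with x hx
  rw [hx, hη]

open Complex in
/-- A linear image of a spherical Gaussian vector is a multivariate Gaussian vector. -/
theorem map_mulVec_pi_gaussianReal {m p : ℕ} (A : Matrix (Fin p) (Fin m) ℝ) (v : ℝ≥0) :
    (Measure.pi fun _ : Fin m => gaussianReal 0 v).map (fun w => WithLp.toLp 2 (A *ᵥ w)) =
      multivariateGaussian 0 ((v : ℝ) • (A * Aᵀ)) := by
  have hmeas : Measurable fun w : Fin m → ℝ => WithLp.toLp 2 (A *ᵥ w) := by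
    have : Continuous fun w : Fin m → ℝ => A *ᵥ w := by fun_prop
    exact (WithLp.measurable_toLp 2 _).comp this.measurable
  have : IsProbabilityMeasure ((Measure.pi fun _ : Fin m => gaussianReal 0 v).map
      (fun w => WithLp.toLp 2 (A *ᵥ w))) := Measure.isProbabilityMeasure_map hmeas.aemeasurable
  have hpsd : ((v : ℝ) • (A * Aᵀ)).PosSemidef := by
    have := posSemidef_self_mul_conjTranspose A
    rw [conjTranspose_eq_transpose_of_trivial] at this
    exact this.smul v.2
  -- A Aᵀ may be singular, so characteristic functions are compared instead of densities.
  refine Measure.ext_of_charFun (funext fun t => ?_)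
  rw [charFun_multivariateGaussian hpsd]
  have h1 : charFun ((Measure.pi fun _ : Fin m => gaussianReal 0 v).map
      (fun w => WithLp.toLp 2 (A *ᵥ w))) t =
      charFun ((Measure.pi fun _ : Fin m => gaussianReal 0 v).map (WithLp.toLp 2))
        (WithLp.toLp 2 (Aᵀ *ᵥ t.ofLp)) := by
    rw [charFun_apply, charFun_apply, integral_map hmeas.aemeasurable
      (Continuous.aestronglyMeasurable (by fun_prop)),
      integral_map (WithLp.measurable_toLp 2 _).aemeasurable
      (Continuous.aestronglyMeasurable (by fun_prop))]
    refine integral_congr_ae (Filter.Eventually.of_forall fun w => ?_)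
    simp only [EuclideanSpace.inner_eq_star_dotProduct, star_trivial]
    rw [dotProduct_mulVec, mulVec_transpose]
  rw [h1, charFun_pi]
  simp only [charFun_gaussianReal]
  rw [← Complex.exp_sum]
  congr 1
  have h2 : t.ofLp ⬝ᵥ (((v : ℝ) • (A * Aᵀ)) *ᵥ t.ofLp) = v * ∑ i, (Aᵀ *ᵥ t.ofLp) i ^ 2 := by
    rw [smul_mulVec, dotProduct_smul, ← mulVec_mulVec, dotProduct_mulVec, ← mulVec_transpose,
      smul_eq_mul]
    simp [dotProduct, sq]
  rw [h2]
  simp only [ofReal_zero, mul_zero, zero_mul, zero_sub, inner_zero_right]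
  push_cast
  rw [Finset.sum_neg_distrib, ← Finset.sum_div, ← Finset.mul_sum]

/-- Allowing c to exceed the variance gives one tail bound for all designs whose empirical variance
is at most 3/2. -/
theorem hasSubgaussianMGF_dotProduct_pi_gaussianReal {m : ℕ} (a : Fin m → ℝ) (v : ℝ≥0) {c : ℝ≥0}
    (hc : ∑ k, a k ^ 2 * v ≤ c) :
    HasSubgaussianMGF (fun w => a ⬝ᵥ w) c (Measure.pi fun _ : Fin m => gaussianReal 0 v) := by
  have h1 : ∀ k : Fin m, HasSubgaussianMGF (fun w : Fin m → ℝ => a k * w k)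
      (Real.toNNReal (a k ^ 2 * v)) (Measure.pi fun _ : Fin m => gaussianReal 0 v) := by
    intro k
    have hmap := (measurePreserving_eval (fun _ : Fin m => gaussianReal 0 v) k).map_eq
    refine ⟨fun t => ?_, fun t => ?_⟩
    · have := integrable_exp_mul_gaussianReal (μ := 0) (v := v) (t * a k)
      rw [← hmap] at this
      have h2 := this.comp_measurable (measurable_pi_apply k)
      refine h2.congr (Filter.Eventually.of_forall fun w => ?_)
      simp [mul_assoc]
    · rw [mgf_const_mul, mgf_gaussianReal hmap, Real.coe_toNNReal _ (by positivity)]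
      apply le_of_eq
      congr 1
      ring
  have hind : iIndepFun (fun (k : Fin m) (w : Fin m → ℝ) => a k * w k)
      (Measure.pi fun _ : Fin m => gaussianReal 0 v) :=
    iIndepFun_pi (X := fun k x => a k * x) fun k => by fun_prop
  have h2 := HasSubgaussianMGF.sum_of_iIndepFun hind (s := Finset.univ) fun k _ => h1 k
  refine ⟨h2.integrable_exp_mul, fun t => (h2.mgf_le t).trans ?_⟩
  apply Real.exp_le_exp.2
  have : ((∑ k, Real.toNNReal (a k ^ 2 * v) : ℝ≥0) : ℝ) ≤ c := by
    push_cast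
    refine le_trans (le_of_eq (Finset.sum_congr rfl fun k _ => ?_)) hc
    exact max_eq_left (by positivity)
  gcongr

theorem measure_pi_gaussianReal_abs_dotProduct_gt_le {m : ℕ} (a : Fin m → ℝ) (v : ℝ≥0) {c : ℝ≥0}
    (hc : ∑ k, a k ^ 2 * v ≤ c) {ε : ℝ} (hε : 0 ≤ ε) :
    (Measure.pi fun _ : Fin m => gaussianReal 0 v) {w | ε < |a ⬝ᵥ w|} ≤
      ENNReal.ofReal (2 * Real.exp (-ε ^ 2 / (2 * c))) := by
  have hs := hasSubgaussianMGF_dotProduct_pi_gaussianReal a v hc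
  have h1 := hs.measure_ge_le hε
  have h2 := hs.neg.measure_ge_le hε
  rw [two_mul, ENNReal.ofReal_add (by positivity) (by positivity)]
  refine (measure_mono (t := {w | ε ≤ a ⬝ᵥ w} ∪ {w | ε ≤ -(a ⬝ᵥ w)}) fun w hw => ?_).trans
    ((measure_union_le _ _).trans (add_le_add ?_ ?_))
  · have hw' : ε < |a ⬝ᵥ w| := hw
    rcases lt_abs.1 hw' with h | h
    · exact Or.inl h.le
    · exact Or.inr h.le
  · rw [← ofReal_measureReal]; exact ENNReal.ofReal_le_ofReal h1
  · rw [← ofReal_measureReal]; exact ENNReal.ofReal_le_ofReal h2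

section Model

variable {Ω : Type*} [MeasurableSpace Ω] {P : Measure Ω} {n p : ℕ}
  {X : Ω → Matrix (Fin n) (Fin p) ℝ} {W Y : Ω → Fin n → ℝ} {θ₀ : Fin p → ℝ} {σ : ℝ}

theorem measurable_matrix_entry (i : Fin n) (j : Fin p) :
    Measurable fun x : Matrix (Fin n) (Fin p) ℝ => x i j :=
  (measurable_pi_apply (X := fun _ : Fin p => ℝ) j).comp
    (measurable_pi_apply (X := fun _ : Fin n => Fin p → ℝ) i)

theorem measurable_noiseTerm {M : Matrix (Fin n) (Fin p) ℝ → Matrix (Fin p) (Fin p) ℝ}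
    (hM : Measurable M) :
    Measurable fun z : Matrix (Fin n) (Fin p) ℝ × (Fin n → ℝ) =>
      WithLp.toLp 2 (noiseTerm (M z.1) z.1 z.2) := by
  refine (WithLp.measurable_toLp 2 _).comp (measurable_pi_lambda _ fun i => ?_)
  simp only [noiseTerm, Pi.smul_apply, mulVec, dotProduct, mul_apply, transpose_apply, smul_eq_mul]
  have h1 : ∀ j, Measurable fun z : Matrix (Fin n) (Fin p) ℝ × (Fin n → ℝ) => M z.1 i j :=
    fun j => (measurable_matrix_entry i j).comp (hM.comp measurable_fst)
  have h2 : ∀ k j, Measurable fun z : Matrix (Fin n) (Fin p) ℝ × (Fin n → ℝ) => z.1 k j :=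
    fun k j => (measurable_matrix_entry k j).comp measurable_fst
  have h3 : ∀ k, Measurable fun z : Matrix (Fin n) (Fin p) ℝ × (Fin n → ℝ) => z.2 k :=
    fun k => (measurable_pi_apply k).comp measurable_snd
  exact (Finset.measurable_fun_sum _ fun k _ => (Finset.measurable_fun_sum _ fun j _ =>
    (h1 j).mul (h2 k j)).mul (h3 k)).const_mul _

/-- The law of the noise term for a fixed design. -/
theorem map_noiseTerm (M : Matrix (Fin p) (Fin p) ℝ) (x : Matrix (Fin n) (Fin p) ℝ) :
    (Measure.pi fun _ : Fin n => gaussianReal 0 (Real.toNNReal (σ ^ 2))).map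
      (fun w => WithLp.toLp 2 (noiseTerm M x w)) =
        multivariateGaussian 0 (σ ^ 2 • (M * sampleCov x * Mᵀ)) := by
  have h := map_mulVec_pi_gaussianReal ((1 / √(n : ℝ)) • (M * xᵀ)) (Real.toNNReal (σ ^ 2))
  have e : ((Real.toNNReal (σ ^ 2) : ℝ≥0) : ℝ) • ((1 / √(n : ℝ)) • (M * xᵀ) *
      ((1 / √(n : ℝ)) • (M * xᵀ))ᵀ) = σ ^ 2 • (M * sampleCov x * Mᵀ) := by
    rw [Real.coe_toNNReal _ (sq_nonneg σ), sampleCov, transpose_smul, transpose_mul,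
      transpose_transpose, Matrix.smul_mul, Matrix.mul_smul, Matrix.mul_smul, Matrix.smul_mul]
    simp only [smul_smul, Matrix.mul_assoc]
    rw [div_mul_div_comm, one_mul, Real.mul_self_sqrt (Nat.cast_nonneg n)]
  rw [e] at h
  rw [← h]
  congr 1
  ext w : 1
  rw [smul_mulVec, noiseTerm]

theorem LinearModel.condDistrib_noiseTerm [IsProbabilityMeasure P]
    (hm : LinearModel P X W Y θ₀ σ)
    {M : Matrix (Fin n) (Fin p) ℝ → Matrix (Fin p) (Fin p) ℝ} (hM : Measurable M) :
    AEMeasurable (fun ω => WithLp.toLp 2 (noiseTerm (M (X ω)) (X ω) (W ω))) P ∧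
      ∀ᵐ x ∂(P.map X),
        condDistrib (fun ω => WithLp.toLp 2 (noiseTerm (M (X ω)) (X ω) (W ω))) X P x =
          multivariateGaussian 0 (σ ^ 2 • (M x * sampleCov x * (M x)ᵀ)) := by
  have hX := hm.aemeasurable_design
  have hW := hm.noise_law.aemeasurable
  have hg := measurable_noiseTerm hM
  have hZ := hg.comp_aemeasurable (hX.prodMk hW)
  refine ⟨hZ, ?_⟩
  have h := condDistrib_ae_eq_map_of_indepFun hX hW hm.indep hg
  rw [hm.noise_law.map_eq] at h
  filter_upwards [h] with x hx
  exact hx.trans (map_noiseTerm (M x) x)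

/-- The noise correlates little with a column of the design whose empirical variance is at most
`3 / 2`. -/
theorem LinearModel.measure_noise_gt_le [IsProbabilityMeasure P]
    (hm : LinearModel P X W Y θ₀ σ) (hn : 0 < n) (hσ : 0 < σ) {lam : ℝ} (hlam : 0 ≤ lam)
    (j : Fin p) :
    P {ω | sampleCov (X ω) j j ≤ 3 / 2 ∧ n * (lam / 2) < |((X ω)ᵀ *ᵥ W ω) j|} ≤
      ENNReal.ofReal (2 * Real.exp (-(n * lam ^ 2 / (12 * σ ^ 2)))) := by
  have hX := hm.aemeasurable_design
  have hW := hm.noise_law.aemeasurable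
  have hn' : (0 : ℝ) < n := by exact_mod_cast hn
  set ν := Measure.pi fun _ : Fin n => gaussianReal 0 (Real.toNNReal (σ ^ 2)) with hν
  have : IsProbabilityMeasure (P.map X) := Measure.isProbabilityMeasure_map hX
  have hpair : P.map (fun ω => (X ω, W ω)) = (P.map X).prod ν := by
    rw [hν, ← hm.noise_law.map_eq]
    exact (indepFun_iff_map_prod_eq_prod_map_map hX hW).1 hm.indep
  have hcov : ∀ x : Matrix (Fin n) (Fin p) ℝ, sampleCov x j j = 1 / n * ∑ k, x k j ^ 2 := by
    intro x
    simp [sampleCov, mul_apply, sq]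
  let s : Set (Matrix (Fin n) (Fin p) ℝ × (Fin n → ℝ)) :=
    {z | 1 / n * ∑ k, z.1 k j ^ 2 ≤ 3 / 2} ∩ {z | n * (lam / 2) < |∑ k, z.1 k j * z.2 k|}
  have hent : ∀ k, Measurable fun z : Matrix (Fin n) (Fin p) ℝ × (Fin n → ℝ) => z.1 k j :=
    fun k => (measurable_matrix_entry k j).comp measurable_fst
  have hs : MeasurableSet s := by
    refine MeasurableSet.inter (measurableSet_le ?_ measurable_const)
      (measurableSet_lt measurable_const ?_)
    · exact (Finset.measurable_fun_sum _ fun k _ => (hent k).pow_const 2).const_mul _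
    · exact (Finset.measurable_fun_sum _ fun k _ => (hent k).mul
        ((measurable_pi_apply k).comp measurable_snd)).abs
  have hset : {ω | sampleCov (X ω) j j ≤ 3 / 2 ∧ n * (lam / 2) < |((X ω)ᵀ *ᵥ W ω) j|} =
      (fun ω => (X ω, W ω)) ⁻¹' s := by
    ext ω
    simp only [hcov]
    rfl
  rw [hset, ← Measure.map_apply_of_aemeasurable (hX.prodMk hW) hs, hpair, Measure.prod_apply hs]
  -- For a fixed design the correlation is Gaussian with variance at most 3nσ²/2, or else the
  -- section is empty. The threshold nλ/2 then gives the exponent nλ²/(12σ²).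
  have hbound : ∀ x, ν (Prod.mk x ⁻¹' s) ≤
      ENNReal.ofReal (2 * Real.exp (-(n * lam ^ 2 / (12 * σ ^ 2)))) := by
    intro x
    by_cases hx : 1 / (n : ℝ) * ∑ k, x k j ^ 2 ≤ 3 / 2
    · have hc : ∑ k, (fun k => x k j) k ^ 2 * (Real.toNNReal (σ ^ 2) : ℝ≥0) ≤
          ((Real.toNNReal (3 / 2 * n * σ ^ 2) : ℝ≥0) : ℝ) := by
        rw [Real.coe_toNNReal _ (sq_nonneg σ), Real.coe_toNNReal _ (by positivity),
          ← Finset.sum_mul]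
        refine mul_le_mul_of_nonneg_right ?_ (sq_nonneg σ)
        rwa [one_div, inv_mul_le_iff₀ hn', mul_comm] at hx
      refine (measure_mono fun w hw => ?_).trans
        ((measure_pi_gaussianReal_abs_dotProduct_gt_le (fun k => x k j) _ hc
          (ε := n * (lam / 2)) (by positivity)).trans (le_of_eq ?_))
      · exact hw.2
      · rw [Real.coe_toNNReal _ (by positivity)]
        congr 3
        field_simp
        ring
    · have : Prod.mk x ⁻¹' s = ∅ := by
        ext w
        simp only [Set.mem_preimage, Set.mem_empty_iff_false, iff_false]
        exact fun h => hx h.1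
      rw [this, measure_empty]
      exact zero_le
  calc ∫⁻ x, ν (Prod.mk x ⁻¹' s) ∂(P.map X)
      ≤ ∫⁻ _, ENNReal.ofReal (2 * Real.exp (-(n * lam ^ 2 / (12 * σ ^ 2)))) ∂(P.map X) :=
        lintegral_mono hbound
    _ = _ := by simp

end Model

end

/-! ### Union bounds and assembly of the tail bound. -/

section

theorem measure_exists_le_card_mul {Ω ι : Type*} [MeasurableSpace Ω] [Fintype ι] {P : Measure Ω}
    {s : ι → Set Ω} {b : ℝ} (h : ∀ i, P (s i) ≤ ENNReal.ofReal b) :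
    P {ω | ∃ i, ω ∈ s i} ≤ ENNReal.ofReal (Fintype.card ι * b) := by
  have e : {ω | ∃ i, ω ∈ s i} = ⋃ i, s i := by ext; simp
  rw [e]
  calc P (⋃ i, s i) ≤ ∑ i, P (s i) := measure_iUnion_fintype_le P s
    _ ≤ ∑ _i : ι, ENNReal.ofReal b := Finset.sum_le_sum fun i _ => h i
    _ = _ := by
      rw [Finset.sum_const, nsmul_eq_mul, Finset.card_univ,
        ENNReal.ofReal_mul (Nat.cast_nonneg _), ENNReal.ofReal_natCast]

theorem exp_one_sq_lt : Real.exp 1 ^ 2 < 7.5 := by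
  have h1 := Real.exp_one_lt_d9
  have h2 := Real.exp_pos 1
  nlinarith

/-- Stars and bars count at most (2p + k)^k / k! multisets, and k^k / k! ≤ e^k. -/
theorem log_card_sym_le {p k : ℕ} (hk : 0 < k) :
    Real.log (Fintype.card (Sym (Fin p × Bool) k)) ≤ k * (1 + Real.log (1 + 2 * p / k)) := by
  have hk' : (0 : ℝ) < k := by exact_mod_cast hk
  have hpos : (0 : ℝ) < 1 + 2 * p / k := by positivity
  rw [Sym.card_sym_eq_choose, Fintype.card_prod, Fintype.card_fin, Fintype.card_bool]
  -- The binomial vanishes only for p = 0; the logarithm then takes its default value 0.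
  rcases Nat.eq_zero_or_pos ((p * 2 + k - 1).choose k) with h0 | h0
  · rw [h0]
    simp only [Nat.cast_zero, Real.log_zero]
    have : 0 ≤ Real.log (1 + 2 * p / k) := Real.log_nonneg (by
      have : (0 : ℝ) ≤ 2 * p / k := by positivity
      linarith)
    positivity
  have hle : (((p * 2 + k - 1).choose k : ℕ) : ℝ) ≤ (Real.exp 1 * (1 + 2 * p / k)) ^ k := by
    calc (((p * 2 + k - 1).choose k : ℕ) : ℝ) ≤ ((p * 2 + k - 1 : ℕ) : ℝ) ^ k / k.factorial :=
          Nat.choose_le_pow_div k _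
      _ ≤ (2 * p + k : ℝ) ^ k / k.factorial := by
          gcongr
          calc ((p * 2 + k - 1 : ℕ) : ℝ) ≤ ((p * 2 + k : ℕ) : ℝ) := by
                exact_mod_cast Nat.sub_le _ _
            _ = 2 * p + k := by push_cast; ring
      _ = (1 + 2 * p / k) ^ k * ((k : ℝ) ^ k / k.factorial) := by
          rw [mul_div_assoc', ← mul_pow, add_mul, div_mul_cancel₀ _ hk'.ne', one_mul, add_comm]
      _ ≤ (1 + 2 * p / k) ^ k * Real.exp 1 ^ k := by
          gcongr; exact natCast_pow_div_factorial_le k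
      _ = _ := by rw [mul_pow, mul_comm]
  calc Real.log _ ≤ Real.log ((Real.exp 1 * (1 + 2 * p / k)) ^ k) :=
        Real.log_le_log (by exact_mod_cast h0) hle
    _ = _ := by rw [Real.log_pow, Real.log_mul (Real.exp_pos 1).ne' hpos.ne', Real.log_exp]

/-- The entropy of sums of `k ≲ r s₀` signed basis vectors. -/
theorem log_card_sym_le_of_le {p k s₀ : ℕ} {r : ℝ} (hs₀ : 1 ≤ s₀) (hk : s₀ ≤ k)
    (hkr : (k : ℝ) ≤ 50 * s₀ * r) :
    Real.log (Fintype.card (Sym (Fin p × Bool) k)) ≤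
      250 * s₀ * r * Real.log (max ((p : ℝ) / s₀) 2) := by
  have hs' : (1 : ℝ) ≤ s₀ := by exact_mod_cast hs₀
  have hks : (s₀ : ℝ) ≤ k := by exact_mod_cast hk
  set q := max ((p : ℝ) / s₀) 2 with hq
  have hq2 : 2 ≤ q := le_max_right _ _
  have hL : 0.69 ≤ Real.log q :=
    (by linarith [Real.log_two_gt_d9] : (0.69 : ℝ) ≤ Real.log 2).trans
      (Real.log_le_log (by norm_num) hq2)
  -- The floor 2 in q absorbs the constants: 1 + 2q ≤ q³ here, and 1 ≤ 2 log q below.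
  have h1 : Real.log (1 + 2 * p / k) ≤ 3 * Real.log q := by
    have : 3 * Real.log q = Real.log (q ^ 3) := by rw [Real.log_pow]; norm_num
    rw [this]
    refine Real.log_le_log (by positivity) ?_
    have h2 : 2 * p / (k : ℝ) ≤ 2 * q := by
      calc 2 * p / (k : ℝ) ≤ 2 * p / s₀ := by gcongr
        _ = 2 * (p / s₀) := by ring
        _ ≤ 2 * q := by gcongr; exact le_max_left _ _
    nlinarith [mul_nonneg (sub_nonneg.2 hq2) (sub_nonneg.2 hq2)]
  calc Real.log (Fintype.card (Sym (Fin p × Bool) k)) ≤ k * (1 + Real.log (1 + 2 * p / k)) :=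
        log_card_sym_le (by omega)
    _ ≤ k * (5 * Real.log q) := by gcongr; linarith
    _ ≤ 50 * s₀ * r * (5 * Real.log q) := by gcongr
    _ = _ := by ring

namespace SubGaussianDesign

variable {Ω : Type*} [MeasurableSpace Ω] {P : Measure Ω}
variable {n p : ℕ} {X : Ω → Matrix (Fin n) (Fin p) ℝ} {S : Matrix (Fin p) (Fin p) ℝ}
  {Cmin Cmax κ : ℝ}

theorem single_quadForm (A : Matrix (Fin p) (Fin p) ℝ) (j : Fin p) :
    (Pi.single j 1 : Fin p → ℝ) ⬝ᵥ (A *ᵥ Pi.single j 1) = A j j := by simp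

theorem diag_le_of_eigenvalues (D : SubGaussianDesign P X S Cmin Cmax κ) (j : Fin p) :
    S j j ≤ Cmax := by
  have := le_mul_sum_sq_of_eigenvalues_le D.symm (fun j => (D.eigenvalues_mem j).2)
    (Pi.single j 1)
  rw [single_quadForm] at this
  simpa [Pi.single_apply] using this

theorem diag_pos (D : SubGaussianDesign P X S Cmin Cmax κ) (hC : 0 < Cmin) (j : Fin p) :
    0 < S j j := by
  rw [← single_quadForm S j]
  exact D.quadForm_pos hC (Pi.single_ne_zero_iff.2 one_ne_zero)

/-- In dimension zero there is no unit vector, so the supremum defining the sub-Gaussian norm is 0.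
-/
theorem dimension_pos (D : SubGaussianDesign P X S Cmin Cmax κ) (hn : 0 < n) (hκ : 0 < κ) :
    0 < p := by
  rcases Nat.eq_zero_or_pos p with rfl | h
  · have := D.psi2 ⟨0, hn⟩
    have h0 : psi2NormVec P (fun ω => (X ω * invSqrt S) ⟨0, hn⟩) = 0 := by simp [psi2NormVec]
    exact absurd (h0.symm.trans this) (ENNReal.ofReal_pos.2 hκ).ne
  · exact h

/-- All empirical variances are at most `3 / 2` times the true ones with high probability. -/
theorem measure_exists_diag_gt_le [IsProbabilityMeasure P]
    (D : SubGaussianDesign P X S Cmin Cmax κ) (hn : 0 < n) (hp : 0 < p)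
    (hC : 0 < Cmin) (hκ : 0 < κ) (hX : AEMeasurable X P)
    (hlog : 1600 * κ ^ 4 * Real.log p ≤ n) :
    P {ω | ∃ j, ω ∈ {ω | 3 / 2 * S j j < sampleCov (X ω) j j}} ≤
      ENNReal.ofReal (Real.exp (-(1 / (8000 * κ ^ 4)) * n)) := by
  have h2κ := D.one_le_two_mul_sq hC hκ hX ⟨0, hn⟩ ⟨0, hp⟩
  have he : 1 ≤ Real.exp 1 := Real.one_le_exp zero_le_one
  have hp' : (0 : ℝ) < p := by exact_mod_cast hp
  -- Chosen so that Bernstein's deviation is Σ_jj/2. The exponent y²/6 is at least 1/(720κ⁴), and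
  -- 1/720 − 1/1600 ≥ 1/8000 pays for the union over p coordinates.
  set y := 1 / (4 * Real.exp 1 * κ ^ 2) with hy
  have hy0 : 0 ≤ y := by positivity
  have hy1 : y ≤ 1 := by
    rw [hy, div_le_one (by positivity)]; nlinarith
  have hone : ∀ j, P {ω | 3 / 2 * S j j < sampleCov (X ω) j j} ≤
      ENNReal.ofReal (Real.exp (-(n * (y ^ 2 / 6)))) := by
    intro j
    have hne : (Pi.single j 1 : Fin p → ℝ) ≠ 0 := Pi.single_ne_zero_iff.2 one_ne_zero
    refine (measure_mono fun ω hω => ?_).trans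
      (D.measure_sampleCov_ge_le hn hC hκ hX hne hne hy0 hy1)
    simp only [Set.mem_ofPred_eq, single_quadForm, Real.mul_self_sqrt (D.diag_pos hC j).le] at hω ⊢
    have : y * (Real.exp 1 * (2 * κ ^ 2 * S j j)) = 1 / 2 * S j j := by
      rw [hy]; field_simp; norm_num
    linarith
  refine (measure_exists_le_card_mul hone).trans (ENNReal.ofReal_le_ofReal ?_)
  rw [Fintype.card_fin]
  nth_rewrite 1 [← Real.exp_log hp']
  rw [← Real.exp_add]
  apply Real.exp_le_exp.2
  have h1 : Real.log p ≤ n / (1600 * κ ^ 4) := by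
    rw [le_div_iff₀ (by positivity)]; linarith
  have h2 : 1 / (720 * κ ^ 4) ≤ y ^ 2 / 6 := by
    rw [hy, div_pow, div_div]
    apply div_le_div₀ (by norm_num) (by norm_num) (by positivity)
    have : 0 < κ ^ 4 := by positivity
    nlinarith [exp_one_sq_lt]
  have h3 : (n : ℝ) * (1 / (720 * κ ^ 4)) ≤ n * (y ^ 2 / 6) := by gcongr
  have h4 : 0 ≤ (n : ℝ) / κ ^ 4 := by positivity
  have e1 : (n : ℝ) / (1600 * κ ^ 4) = 1 / 1600 * (n / κ ^ 4) := by field_simp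
  have e2 : (n : ℝ) * (1 / (720 * κ ^ 4)) = 1 / 720 * (n / κ ^ 4) := by field_simp
  have e3 : -(1 / (8000 * κ ^ 4)) * n = -(1 / 8000 * (n / κ ^ 4)) := by field_simp
  rw [e3]
  rw [e1] at h1
  rw [e2] at h3
  linarith

/-- The sample covariance is bounded below on all sums of `k` signed basis vectors with high
probability. -/
theorem measure_exists_sym_lt_le [IsProbabilityMeasure P]
    (D : SubGaussianDesign P X S Cmin Cmax κ) (hn : 0 < n) (hp : 0 < p)
    (hC : 0 < Cmin) (hκ : 0 < κ) (hX : AEMeasurable X P) {k : ℕ}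
    (hlog : 8000 * κ ^ 4 * Real.log (Fintype.card (Sym (Fin p × Bool) k)) ≤ n) :
    P {ω | ∃ s : Sym (Fin p × Bool) k, ω ∈ {ω |
        ((s : Multiset (Fin p × Bool)).map signedBasis).sum ⬝ᵥ
          (sampleCov (X ω) *ᵥ ((s : Multiset (Fin p × Bool)).map signedBasis).sum) <
        3 / 4 * (((s : Multiset (Fin p × Bool)).map signedBasis).sum ⬝ᵥ
          (S *ᵥ ((s : Multiset (Fin p × Bool)).map signedBasis).sum))}} ≤
      ENNReal.ofReal (Real.exp (-(1 / (8000 * κ ^ 4)) * n)) := by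
  have h2κ := D.one_le_two_mul_sq hC hκ hX ⟨0, hn⟩ ⟨0, hp⟩
  have he : 1 ≤ Real.exp 1 := Real.one_le_exp zero_le_one
  have : Nonempty (Fin p × Bool) := ⟨⟨0, hp⟩, true⟩
  have hcard : (0 : ℝ) < Fintype.card (Sym (Fin p × Bool) k) := by
    have : 0 < Fintype.card (Sym (Fin p × Bool) k) :=
      Fintype.card_pos_iff.2 ⟨Sym.replicate k (⟨0, hp⟩, true)⟩
    exact_mod_cast this
  set y := 1 / (8 * Real.exp 1 * κ ^ 2) with hy
  have hy0 : 0 ≤ y := by positivity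
  have hy1 : y ≤ 1 := by
    rw [hy, div_le_one (by positivity)]; nlinarith
  refine (measure_exists_le_card_mul (b := Real.exp (-(n * (y ^ 2 / 6))))
    fun s => ?_).trans (ENNReal.ofReal_le_ofReal ?_)
  · set z := ((s : Multiset (Fin p × Bool)).map signedBasis).sum
    -- Opposite signs may cancel, and concentration is available only at nonzero vectors.
    by_cases hz : z = 0
    · simp [hz]
    refine (measure_mono fun ω hω => ?_).trans
      (D.measure_sampleCov_le_le hn hC hκ hX hz hz hy0 hy1)
    simp only [Set.mem_ofPred_eq, Real.mul_self_sqrt (D.quadForm_pos hC hz).le] at hω ⊢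
    have : y * (Real.exp 1 * (2 * κ ^ 2 * (z ⬝ᵥ (S *ᵥ z)))) = 1 / 4 * (z ⬝ᵥ (S *ᵥ z)) := by
      rw [hy]; field_simp; ring
    linarith
  nth_rewrite 1 [← Real.exp_log hcard]
  rw [← Real.exp_add]
  apply Real.exp_le_exp.2
  -- Half of the exponent 1/(4000κ⁴) is spent on the number of sums; the other half is the final
  -- rate.
  have h1 : Real.log (Fintype.card (Sym (Fin p × Bool) k)) ≤ n / (8000 * κ ^ 4) := by
    rw [le_div_iff₀ (by positivity)]; linarith
  have h2 : 1 / (4000 * κ ^ 4) ≤ y ^ 2 / 6 := by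
    rw [hy, div_pow, div_div]
    apply div_le_div₀ (by norm_num) (by norm_num) (by positivity)
    have : 0 < κ ^ 4 := by positivity
    nlinarith [exp_one_sq_lt]
  have h3 : (n : ℝ) * (1 / (4000 * κ ^ 4)) ≤ n * (y ^ 2 / 6) := by gcongr
  have e1 : (n : ℝ) / (8000 * κ ^ 4) = 1 / 8000 * (n / κ ^ 4) := by field_simp
  have e2 : (n : ℝ) * (1 / (4000 * κ ^ 4)) = 1 / 4000 * (n / κ ^ 4) := by field_simp
  have e3 : -(1 / (8000 * κ ^ 4)) * n = -(1 / 8000 * (n / κ ^ 4)) := by field_simp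
  rw [e3]
  rw [e1] at h1
  rw [e2] at h3
  linarith

theorem exists_left_inverse (D : SubGaussianDesign P X S Cmin Cmax κ) (hC : 0 < Cmin) :
    ∃ M' : Matrix (Fin p) (Fin p) ℝ, M' * S = 1 := by
  have hinj : Function.Injective S.mulVec := by
    intro u v huv
    by_contra hne
    have := D.quadForm_pos hC (sub_ne_zero.2 hne)
    rw [mulVec_sub, sub_eq_zero.2 huv, dotProduct_zero] at this
    exact lt_irrefl _ this
  exact ⟨S⁻¹, nonsing_inv_mul S ((isUnit_iff_isUnit_det S).1 (mulVec_injective_iff_isUnit.1 hinj))⟩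

/-- The inverse covariance approximately inverts the sample covariance. -/
theorem measure_exists_entry_gt_le [IsProbabilityMeasure P]
    (D : SubGaussianDesign P X S Cmin Cmax κ) (hn : 0 < n) (hp : 0 < p)
    (hC : 0 < Cmin) (hκ : 0 < κ) (hX : AEMeasurable X P) {a : ℝ} (ha : 0 < a)
    (hlog : a ^ 2 / (4 * Real.exp 1 ^ 2 * κ ^ 4) * Real.log p ≤ n)
    {M' : Matrix (Fin p) (Fin p) ℝ} (hM' : M' * S = 1) :
    P {ω | ∃ e : Fin p × Fin p, ω ∈ {ω | a * √(Real.log p / n) <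
        |(M' * sampleCov (X ω) - 1) e.1 e.2|}} ≤
      ENNReal.ofReal (2 * (p : ℝ) ^
        (-(a ^ 2 * Cmin / (24 * Real.exp 1 ^ 2 * κ ^ 4 * Cmax) - 2))) := by
  have hn' : (0 : ℝ) < n := by exact_mod_cast hn
  have hp' : (0 : ℝ) < p := by exact_mod_cast hp
  have hlp : 0 ≤ Real.log p := Real.log_natCast_nonneg p
  have hCC : Cmin ≤ Cmax := (D.eigenvalues_mem ⟨0, hp⟩).1.trans (D.eigenvalues_mem ⟨0, hp⟩).2
  have hCmax : 0 < Cmax := hC.trans_le hCC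
  set mu := a * √(Real.log p / n) with hmu
  have hmu0 : 0 ≤ mu := by positivity
  have hmu2 : mu ^ 2 = a ^ 2 * (Real.log p / n) := by
    rw [hmu, mul_pow, Real.sq_sqrt (by positivity)]
  have hmule : mu ≤ 2 * Real.exp 1 * κ ^ 2 := by
    refine abs_le_of_sq_le_sq' ?_ (by positivity) |>.2
    rw [hmu2, mul_div_assoc', div_le_iff₀ hn']
    rw [div_mul_eq_mul_div, div_le_iff₀ (by positivity)] at hlog
    linarith
  set ρ := √(Cmax / Cmin) with hρ
  have hρ1 : 1 ≤ ρ := by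
    rw [hρ, Real.one_le_sqrt, one_le_div hC]; exact hCC
  have hρ2 : ρ ^ 2 = Cmax / Cmin := Real.sq_sqrt (by positivity)
  -- The scale √((Σ⁻¹)_ii Σ_jj) is at most ρ, so this y keeps the deviation below `mu`; the sample
  -- size condition gives y ≤ 1.
  set y := mu / (2 * Real.exp 1 * κ ^ 2 * ρ) with hy
  have hy0 : 0 ≤ y := by positivity
  have hy1 : y ≤ 1 := by
    rw [hy, div_le_one (by positivity)]
    exact hmule.trans (le_mul_of_one_le_right (by positivity) hρ1)
  have hyn : Real.exp (-(n * (y ^ 2 / 6))) =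
      (p : ℝ) ^ (-(a ^ 2 * Cmin / (24 * Real.exp 1 ^ 2 * κ ^ 4 * Cmax))) := by
    rw [Real.rpow_def_of_pos hp', hy, div_pow, mul_pow _ ρ, hρ2, hmu2]
    congr 1
    field_simp
    ring
  have hone : ∀ e : Fin p × Fin p, P {ω | mu < |(M' * sampleCov (X ω) - 1) e.1 e.2|} ≤
      ENNReal.ofReal (2 * (p : ℝ) ^ (-(a ^ 2 * Cmin / (24 * Real.exp 1 ^ 2 * κ ^ 4 * Cmax)))) := by
    rintro ⟨i, j⟩
    set u := M' i with hu
    have huS : u ᵥ* S = Pi.single i 1 := by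
      rw [hu, ← mul_apply_eq_vecMul, hM']
      ext l
      rw [one_apply, Pi.single_apply]
      simp only [eq_comm]
    have hu0 : u ≠ 0 := by
      rintro h0
      rw [h0, zero_vecMul] at huS
      exact (Pi.single_ne_zero_iff.2 one_ne_zero) huS.symm
    have hv0 : (Pi.single j 1 : Fin p → ℝ) ≠ 0 := Pi.single_ne_zero_iff.2 one_ne_zero
    have huu : u ⬝ᵥ (S *ᵥ u) = u i := by
      rw [dotProduct_mulVec, huS]; simp
    -- Since uᵀΣu = u_i, the lower eigenvalue bound reads Cmin u_i² ≤ u_i.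
    have hui : u i ≤ 1 / Cmin := by
      have h1 := mul_sum_sq_le_of_le_eigenvalues D.symm (fun j => (D.eigenvalues_mem j).1) u
      have h2 : u i ^ 2 ≤ ∑ l, u l ^ 2 :=
        Finset.single_le_sum (f := fun l => u l ^ 2) (fun l _ => sq_nonneg _) (Finset.mem_univ i)
      have h3 := D.quadForm_pos hC hu0
      rw [huu] at h1 h3
      rw [le_div_iff₀ hC]
      nlinarith [mul_le_mul_of_nonneg_left h2 hC.le]
    have hprod : √(u ⬝ᵥ (S *ᵥ u)) * √((Pi.single j 1 : Fin p → ℝ) ⬝ᵥ (S *ᵥ Pi.single j 1)) ≤ ρ := by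
      rw [huu, single_quadForm, hρ, ← Real.sqrt_mul (by
        rw [← huu]; exact (D.quadForm_pos hC hu0).le)]
      apply Real.sqrt_le_sqrt
      calc u i * S j j ≤ 1 / Cmin * Cmax := by
            gcongr
            · exact (D.diag_pos hC j).le
            · exact D.diag_le_of_eigenvalues j
        _ = _ := by ring
    have hdev : y * (Real.exp 1 * (2 * κ ^ 2 * (√(u ⬝ᵥ (S *ᵥ u)) *
        √((Pi.single j 1 : Fin p → ℝ) ⬝ᵥ (S *ᵥ Pi.single j 1))))) ≤ mu := by
      calc _ ≤ y * (Real.exp 1 * (2 * κ ^ 2 * ρ)) := by gcongr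
        _ = mu := by rw [hy]; field_simp
    have hentry : ∀ A : Matrix (Fin p) (Fin p) ℝ,
        (M' * A) i j = u ⬝ᵥ (A *ᵥ Pi.single j 1) := by
      intro A
      rw [dotProduct_mulVec, hu, ← mul_apply_eq_vecMul]; simp
    rw [← hyn, two_mul, ENNReal.ofReal_add (by positivity) (by positivity)]
    refine (measure_mono ?_).trans ((measure_union_le _ _).trans (add_le_add
      (D.measure_sampleCov_ge_le hn hC hκ hX hu0 hv0 hy0 hy1)
      (D.measure_sampleCov_le_le hn hC hκ hX hu0 hv0 hy0 hy1)))
    intro ω hω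
    have hω' : mu < |(M' * sampleCov (X ω) - 1) i j| := hω
    rw [← hM', Matrix.sub_apply, hentry, hentry] at hω'
    rcases lt_abs.1 hω' with h | h
    · exact Or.inl (by simp only [Set.mem_ofPred_eq]; linarith)
    · exact Or.inr (by simp only [Set.mem_ofPred_eq]; linarith)
  refine (measure_exists_le_card_mul hone).trans (le_of_eq ?_)
  congr 1
  rw [Fintype.card_prod, Fintype.card_fin, neg_sub, sub_eq_add_neg, Real.rpow_add hp',
    Real.rpow_two]
  push_cast
  ring

end SubGaussianDesign

theorem LinearModel.measure_exists_noise_gt_le {Ω : Type*} [MeasurableSpace Ω] {P : Measure Ω}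
    [IsProbabilityMeasure P] {n p : ℕ} {X : Ω → Matrix (Fin n) (Fin p) ℝ} {W Y : Ω → Fin n → ℝ}
    {θ₀ : Fin p → ℝ} {σ c : ℝ} (hm : LinearModel P X W Y θ₀ σ) (hn : 0 < n) (hp : 0 < p)
    (hσ : 0 < σ) :
    P {ω | ∃ j, ω ∈ {ω | sampleCov (X ω) j j ≤ 3 / 2 ∧
        n * (σ * √(c ^ 2 * Real.log p / n) / 2) < |((X ω)ᵀ *ᵥ W ω) j|}} ≤
      ENNReal.ofReal (2 * (p : ℝ) ^ (-(c ^ 2 / 48 - 1))) := by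
  have hn' : (0 : ℝ) < n := by exact_mod_cast hn
  have hp' : (0 : ℝ) < p := by exact_mod_cast hp
  have hlp : 0 ≤ Real.log p := Real.log_natCast_nonneg p
  refine (measure_exists_le_card_mul
    fun j => hm.measure_noise_gt_le hn hσ (by positivity) j).trans (ENNReal.ofReal_le_ofReal ?_)
  have e : Real.exp (-(n * (σ * √(c ^ 2 * Real.log p / n)) ^ 2 / (12 * σ ^ 2))) =
      (p : ℝ) ^ (-(c ^ 2 / 12)) := by
    rw [Real.rpow_def_of_pos hp', mul_pow, Real.sq_sqrt (by positivity)]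
    congr 1
    field_simp
  rw [e, Fintype.card_fin, mul_left_comm]
  gcongr 2 * ?_
  nth_rewrite 1 [← Real.rpow_one (p : ℝ)]
  rw [← Real.rpow_add hp']
  -- The argument yields c²/12 − 1, which is weakened to c²/48 − 1.
  refine Real.rpow_le_rpow_of_exponent_le (by exact_mod_cast hp) ?_
  nlinarith [sq_nonneg c]

/-- The tail bound for the bias term of a debiasing matrix that is feasible whenever possible. -/
theorem measure_biasTerm_ge_le {Ω : Type*} [MeasurableSpace Ω] {P : Measure Ω}
    [IsProbabilityMeasure P] {n p : ℕ} (hn : 0 < n) {X : Ω → Matrix (Fin n) (Fin p) ℝ}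
    {W Y : Ω → Fin n → ℝ} {θ₀ : Fin p → ℝ} {σ a : ℝ} (hσ : 0 < σ) (ha : 0 < a)
    (hm : LinearModel P X W Y θ₀ σ) {S : Matrix (Fin p) (Fin p) ℝ} {Cmin Cmax κ c : ℝ} {s₀ : ℕ}
    (hC : 0 < Cmin) (hκ : 0 < κ) (hc : 0 < c) (D : SubGaussianDesign P X S Cmin Cmax κ)
    (hs₀ : 1 ≤ s₀) (hs : {j | θ₀ j ≠ 0}.ncard ≤ s₀)
    (hν₀ : 10 ^ 8 * (Cmax / Cmin) ^ 2 * κ ^ 4 * s₀ * Real.log (max ((p : ℝ) / s₀) 2) ≤ n)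
    (hν₁ : 1600 * κ ^ 4 * Real.log p ≤ n)
    (hν₂ : a ^ 2 / (4 * Real.exp 1 ^ 2 * κ ^ 4) * Real.log p ≤ n)
    {θhat : Ω → Fin p → ℝ} {M : Ω → Matrix (Fin p) (Fin p) ℝ}
    (hθ : ∀ ω, IsLasso (Y ω) (X ω) (σ * √(c ^ 2 * Real.log p / n)) (θhat ω))
    (hM : ∀ᵐ ω ∂P, (∃ M', MatrixFeasible (a * √(Real.log p / n)) (X ω) M') →
      MatrixFeasible (a * √(Real.log p / n)) (X ω) (M ω)) :
    P {ω | 16 * a * c * σ / Cmin * (s₀ * Real.log p / √(n : ℝ)) ≤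
        ‖biasTerm (M ω) (X ω) θ₀ (θhat ω)‖} ≤
      ENNReal.ofReal (4 * Real.exp (-(1 / (8000 * κ ^ 4)) * n) +
        4 * (p : ℝ) ^ (-(min (c ^ 2 / 48 - 1)
          (a ^ 2 * Cmin / (24 * Real.exp 1 ^ 2 * κ ^ 4 * Cmax) - 2)))) := by
  have hX := hm.aemeasurable_design
  have hp := D.dimension_pos hn hκ
  have hn' : (0 : ℝ) < n := by exact_mod_cast hn
  have hp' : (1 : ℝ) ≤ p := by exact_mod_cast hp
  set t₁ := c ^ 2 / 48 - 1
  set t₂ := a ^ 2 * Cmin / (24 * Real.exp 1 ^ 2 * κ ^ 4 * Cmax) - 2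
  -- For p = 1 both λ and the threshold are 0, but the right side exceeds 4.
  rcases (Nat.succ_le_of_lt hp).eq_or_lt with hp1 | hp2
  · refine prob_le_one.trans ?_
    rw [← ENNReal.ofReal_one]
    refine ENNReal.ofReal_le_ofReal ?_
    rw [← hp1]
    simp only [Nat.succ_eq_add_one, zero_add, Nat.cast_one, Real.one_rpow]
    linarith [Real.exp_pos (-(1 / (8000 * κ ^ 4)) * n)]
  have hlp : 0 < Real.log p := Real.log_pos (by exact_mod_cast hp2)
  have hCC : Cmin ≤ Cmax := (D.eigenvalues_mem ⟨0, hp⟩).1.trans (D.eigenvalues_mem ⟨0, hp⟩).2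
  have hs' : (1 : ℝ) ≤ s₀ := by exact_mod_cast hs₀
  set r := Cmax / Cmin with hr
  have hr1 : 1 ≤ r := (one_le_div hC).2 hCC
  have hrC : r * Cmin = Cmax := div_mul_cancel₀ _ hC.ne'
  have hsr : 1 ≤ s₀ * r := one_le_mul_of_one_le_of_one_le hs' hr1
  -- The least m admitted by `restricted_eigenvalue`; since s₀r ≥ 1, m + 1 ≤ 50s₀r.
  set m := ⌈48 * s₀ * r⌉₊ with hmdef
  have hm1 : 48 * s₀ * r ≤ m := Nat.le_ceil _
  have hm2 : (m : ℝ) < 48 * s₀ * r + 1 := Nat.ceil_lt_add_one (by positivity)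
  have hm0 : 0 < m := by
    have : (0 : ℝ) < m := by linarith
    exact_mod_cast this
  have hlogq : 0 ≤ Real.log (max ((p : ℝ) / s₀) 2) :=
    Real.log_nonneg ((by norm_num : (1 : ℝ) ≤ 2).trans (le_max_right _ _))
  have hsk : s₀ ≤ m + 1 := by
    have : (s₀ : ℝ) ≤ m := by nlinarith
    have : s₀ ≤ m := by exact_mod_cast this
    omega
  have hent := log_card_sym_le_of_le (p := p) (r := r) hs₀ hsk (by push_cast; linarith)
  have hcard : 8000 * κ ^ 4 * Real.log (Fintype.card (Sym (Fin p × Bool) (m + 1))) ≤ n := by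
    refine le_trans ?_ hν₀
    calc 8000 * κ ^ 4 * Real.log (Fintype.card (Sym (Fin p × Bool) (m + 1)))
        ≤ 8000 * κ ^ 4 * (250 * s₀ * r * Real.log (max ((p : ℝ) / s₀) 2)) := by gcongr
      _ = 2000000 * r * (κ ^ 4 * s₀ * Real.log (max ((p : ℝ) / s₀) 2)) := by ring
      -- The entropy costs only one factor r ≤ r².
      _ ≤ 10 ^ 8 * r ^ 2 * (κ ^ 4 * s₀ * Real.log (max ((p : ℝ) / s₀) 2)) := by
          gcongr ?_ * _
          nlinarith
      _ = _ := by ring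
  obtain ⟨M', hM'⟩ := D.exists_left_inverse hC
  have b1 := D.measure_exists_diag_gt_le hn hp hC hκ hX hν₁
  have b2 := D.measure_exists_sym_lt_le hn hp hC hκ hX hcard
  have b3 := D.measure_exists_entry_gt_le hn hp hC hκ hX ha hν₂ hM'
  have b4 := hm.measure_exists_noise_gt_le (c := c) hn hp hσ
  -- The bad event need not be measurable: it is covered, up to a null set, by four exceptional
  -- events, of total probability at most 2e^{−c₁n} + 2p^{−t₁} + 2p^{−t₂}.
  refine (measure_mono_ae ?_).trans ((measure_union_le _ _).trans (add_le_add
    ((measure_union_le _ _).trans (add_le_add b1 b2))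
    ((measure_union_le _ _).trans (add_le_add b3 b4)))) |>.trans ?_
  · filter_upwards [hM] with ω hMω hω
    by_contra hgood
    have g1 : ∀ j, sampleCov (X ω) j j ≤ 3 / 2 * S j j := fun j => by
      by_contra! h
      exact hgood (Or.inl (Or.inl ⟨j, h⟩))
    have g2 : ∀ s : Multiset (Fin p × Bool), s.card = m + 1 →
        3 / 4 * ((s.map signedBasis).sum ⬝ᵥ (S *ᵥ (s.map signedBasis).sum)) ≤
          (s.map signedBasis).sum ⬝ᵥ (sampleCov (X ω) *ᵥ (s.map signedBasis).sum) := fun s hsc => by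
      by_contra! h
      exact hgood (Or.inl (Or.inr ⟨⟨s, hsc⟩, h⟩))
    have g3 : MatrixFeasible (a * √(Real.log p / n)) (X ω) M' := fun i j => by
      by_contra! h
      exact hgood (Or.inr (Or.inl ⟨(i, j), h⟩))
    have g4 : ∀ j, |((X ω)ᵀ *ᵥ W ω) j| ≤ n * (σ * √(c ^ 2 * Real.log p / n) / 2) := fun j => by
      by_contra! h
      exact hgood (Or.inr (Or.inr ⟨j, by linarith [g1 j, D.diag_le j], h⟩))
    have hl1 := (hθ ω).l1_error_le (hm.response ω) hn (by positivity) hC hs g4 fun h hh =>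
      restricted_eigenvalue hm0 (hC.le.trans hCC) g2 g1 D.diag_le_of_eigenvalues
        (mul_sum_sq_le_of_le_eigenvalues D.symm fun j => (D.eigenvalues_mem j).1)
        (by rw [← hrC]; nlinarith) hh
    have hbias := norm_biasTerm_le (θ₀ := θ₀) (θ := θhat ω) (by positivity) (hMω ⟨M', g3⟩)
    have hω' : 16 * a * c * σ / Cmin * (s₀ * Real.log p / √(n : ℝ)) ≤
      ‖biasTerm (M ω) (X ω) θ₀ (θhat ω)‖ := hω
    refine absurd (hω'.trans hbias) (not_le.2 ?_)
    have hsn : √(n : ℝ) ^ 2 = n := Real.sq_sqrt hn'.le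
    have hsn0 : 0 < √(n : ℝ) := Real.sqrt_pos.2 hn'
    have hsl : √(Real.log p) ^ 2 = Real.log p := Real.sq_sqrt hlp.le
    calc √(n : ℝ) * (a * √(Real.log p / n) * ∑ j, |θ₀ j - θhat ω j|)
        ≤ √(n : ℝ) * (a * √(Real.log p / n) *
            (8 * (σ * √(c ^ 2 * Real.log p / n)) * s₀ / Cmin)) := by gcongr
      _ = 8 * a * c * σ / Cmin * (s₀ * Real.log p / √(n : ℝ)) := by
          rw [Real.sqrt_div hlp.le, Real.sqrt_div (by positivity), Real.sqrt_mul (sq_nonneg c),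
            Real.sqrt_sq hc.le]
          field_simp
          rw [hsl]
      _ < 16 * a * c * σ / Cmin * (s₀ * Real.log p / √(n : ℝ)) := by
          gcongr
          norm_num
  · rw [← ENNReal.ofReal_add (by positivity) (by positivity),
      ← ENNReal.ofReal_add (by positivity) (by positivity),
      ← ENNReal.ofReal_add (by positivity) (by positivity)]
    refine ENNReal.ofReal_le_ofReal ?_
    have r1 : (p : ℝ) ^ (-t₁) ≤ (p : ℝ) ^ (-(min t₁ t₂)) :=
      Real.rpow_le_rpow_of_exponent_le hp' (neg_le_neg (min_le_left _ _))
    have r2 : (p : ℝ) ^ (-t₂) ≤ (p : ℝ) ^ (-(min t₁ t₂)) :=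
      Real.rpow_le_rpow_of_exponent_le hp' (neg_le_neg (min_le_right _ _))
    linarith [Real.exp_pos (-(1 / (8000 * κ ^ 4)) * n)]

end

end DebiasedLasso

open DebiasedLasso in
theorem theorem8 :
    ∃ cstar : ℝ, 0 < cstar ∧ cstar ≤ 2000 ∧
    ∀ (Ω : Type*) [MeasurableSpace Ω] (P : Measure Ω) [IsProbabilityMeasure P]
      (n p : ℕ) (_hn : 0 < n)
      (X : Ω → Matrix (Fin n) (Fin p) ℝ) (W Y : Ω → Fin n → ℝ)
      (θ₀ : Fin p → ℝ) (σ a : ℝ) (_hσ : 0 < σ) (_ha : 0 < a)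
      (_hmodel : LinearModel P X W Y θ₀ σ),
      -- the decomposition and the conditional law of the noise term given the design
      (∀ (lam : ℝ) (θhat : Ω → Fin p → ℝ)
        (M : Matrix (Fin n) (Fin p) ℝ → Matrix (Fin p) (Fin p) ℝ),
        (∀ ω, IsLasso (Y ω) (X ω) lam (θhat ω)) →
        (∀ x, IsAlgorithmMatrix (a * √(Real.log p / n)) x (M x)) →
        (∀ ω, √(n : ℝ) • (debiased (M (X ω)) (Y ω) (X ω) (θhat ω) - θ₀) =
          noiseTerm (M (X ω)) (X ω) (W ω) + biasTerm (M (X ω)) (X ω) θ₀ (θhat ω)) ∧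
        (Measurable M →
          AEMeasurable (fun ω => WithLp.toLp 2 (noiseTerm (M (X ω)) (X ω) (W ω))) P ∧
          ∀ᵐ x ∂(P.map X),
            condDistrib (fun ω => WithLp.toLp 2 (noiseTerm (M (X ω)) (X ω) (W ω))) X P x =
              multivariateGaussian 0 (σ ^ 2 • (M x * sampleCov x * (M x)ᵀ)))) ∧
      -- the tail bound for the bias term
      (∀ (S : Matrix (Fin p) (Fin p) ℝ) (Cmin Cmax κ c : ℝ) (s₀ : ℕ),
        0 < Cmin → 0 < κ → 0 < c →
        SubGaussianDesign P X S Cmin Cmax κ →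
        1 ≤ s₀ → {j | θ₀ j ≠ 0}.ncard ≤ s₀ →
        (5 * 10 ^ 4 * cstar * (Cmax / Cmin) ^ 2 * κ ^ 4) * s₀ * Real.log (max ((p : ℝ) / s₀) 2)
          ≤ n →
        max (1600 * κ ^ 4) (a ^ 2 / (4 * Real.exp 1 ^ 2 * κ ^ 4)) * Real.log p ≤ n →
        ∀ (θhat : Ω → Fin p → ℝ) (M : Matrix (Fin n) (Fin p) ℝ → Matrix (Fin p) (Fin p) ℝ),
          (∀ ω, IsLasso (Y ω) (X ω) (σ * √(c ^ 2 * Real.log p / n)) (θhat ω)) →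
          -- `M` is the matrix of the algorithm, or any function of the design that is feasible
          -- whenever a feasible matrix exists
          ((∀ x, IsAlgorithmMatrix (a * √(Real.log p / n)) x (M x)) ∨
            (∀ᵐ ω ∂P, (∃ M', MatrixFeasible (a * √(Real.log p / n)) (X ω) M') →
              MatrixFeasible (a * √(Real.log p / n)) (X ω) (M (X ω)))) →
          P {ω | 16 * a * c * σ / Cmin * (s₀ * Real.log p / √(n : ℝ)) ≤
                ‖biasTerm (M (X ω)) (X ω) θ₀ (θhat ω)‖} ≤
            ENNReal.ofReal
              (4 * Real.exp (-(1 / (4 * cstar * κ ^ 4)) * n) +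
                4 * (p : ℝ) ^ (-(min (c ^ 2 / 48 - 1)
                  (a ^ 2 * Cmin / (24 * Real.exp 1 ^ 2 * κ ^ 4 * Cmax) - 2))))) := by
  -- A larger constant demands more observations and claims a smaller exponent, so the largest
  -- admissible value is taken: 4 · 2000 = 8000 and 5 · 10⁴ · 2000 = 10⁸.
  refine ⟨2000, by norm_num, le_rfl, ?_⟩
  intro Ω _ P _ n p hn X W Y θ₀ σ a hσ ha hm
  refine ⟨fun lam θhat M _ _ => ⟨fun ω => ?_, fun hM => hm.condDistrib_noiseTerm hM⟩, ?_⟩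
  · exact sqrt_smul_debiased_sub _ _ hn (hm.response ω)
  intro S Cmin Cmax κ c s₀ hC hκ hc D hs₀ hs hν₀ hν₁ θhat M hθ hM
  have hlp : 0 ≤ Real.log p := Real.log_natCast_nonneg p
  have hmu : 0 ≤ a * √(Real.log p / n) := by positivity
  -- The algorithm's matrix is an instance of the general feasible choice, so one tail bound serves
  -- both alternatives.
  have hfeas : ∀ᵐ ω ∂P, (∃ M', MatrixFeasible (a * √(Real.log p / n)) (X ω) M') →
      MatrixFeasible (a * √(Real.log p / n)) (X ω) (M (X ω)) := by
    rcases hM with hM | hM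
    · exact Filter.Eventually.of_forall fun ω ⟨M', hM'⟩ => (hM (X ω)).matrixFeasible hmu hM'
    · exact hM
  have h := measure_biasTerm_ge_le hn hσ ha hm hC hκ hc D hs₀ hs
    (le_trans (le_of_eq (by ring)) hν₀)
    ((mul_le_mul_of_nonneg_right (le_max_left _ _) hlp).trans hν₁)
    ((mul_le_mul_of_nonneg_right (le_max_right _ _) hlp).trans hν₁) hθ hfeas
  rwa [show 4 * 2000 * κ ^ 4 = 8000 * κ ^ 4 by ring]
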